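/- Let $G$ be a Lie group modelled on a Fréchet space (a paracompact Hausdorff Fréchet manifold with smooth group operations), let $A$ be an abelian Lie group of the same kind on which $G$ acts smoothly by automorphisms (for example trivially), and let $n\ge 0$. Let $BG$ be the simplicial manifold with $G^p$ in degree $p$ and the usual face maps $d_j$ and degeneracy maps $s_j$, and let $\underline A$ be the simplicial sheaf on $BG$ which on $G^p$ is the sheaf of smooth $A$-valued functions, with transition maps $d_j^*$ given by pull-back for $j>0$ and by $(d_0^*f)(g_0,\dots,g_p)=g_0\cdot f(g_1,\dots,g_p)$ for $j=0$. Let $H^n_{diff}(G,A)=H^n(BG,\underline A)$ be the hypercohomology of $BG$ with coefficients in $\underline A$ (the derived functors of global sections on simplicial sheaves of abelian groups), and let $H^n_{loc}(G,A)$ be the $n$-th cohomology group of the complex of groups $C^\infty_{loc}(G^p,A)$ of germs at $(1,\dots,1)$ of smooth functions $G^p\to A$, with differential $d_0^*-d_1^*+\cdots+(-1)^{p+1}d_{p+1}^*$ on $C^\infty_{loc}(G^p,A)$. A simplicial family of open sets $\mathcal U$ consists of a simplicial set $J$ and open sets $U^{(p)}_j\subseteq G^p$ for $j\in J_p$ with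 $d_kU^{(p)}_j\subseteq U^{(p-1)}_{d_kj}$ and $s_kU^{(p-1)}_j\subseteq U^{(p)}_{s_kj}$; it is a simplicial open covering if $\{U^{(p)}_j\}_{j\in J_p}$ covers $G^p$ for every $p$. Its Čech double complex is $\mathcal C^r(\mathcal U^{(p)},\underline A)=\prod_{j_0,\dots,j_r\in J_p}C^\infty(U^{(p)}_{j_0}\cap\dots\cap U^{(p)}_{j_r},A)$, with the simplicial differential $\sum_k(-1)^kd_k^*$ and the Čech differential. A cocycle $g=(g^0,\dots,g^n)$ of total degree $n$, with $g^p\in\mathcal C^{n-p}(\mathcal U^{(p)},\underline A)$, is said to represent $x\in H^n_{diff}(G,A)$ if, for some injective resolution $\underline A\to I^\bullet$ by simplicial sheaves and some global section $s$ of $I^n$ over $BG$ with $ds=0$ and class $x$, the images of $g$ and of $s$ in the total complex of $\mathcal C^r(\mathcal U^{(p)},I^q)$ are cohomologous. An index $i\in J_n$ is called distinguished if $1\in U^{(n)}_i$ and $d_0i=d_1i=\dots=d_ni$ (no condition on faces if $n=0$). Then: 1. Every simplicial open covering has a distinguished index $i\in J_n$. 2. For every simplicial family of open sets, every Čech cocycle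 $g=(g^0,\dots,g^n)$ of total degree $n$ and every distinguished $i\in J_n$, the germ at $1$ of $g^n_i$ is a cocycle in $C^\infty_{loc}(G^n,A)$. 3. For two distinguished indices $i,i'\in J_n$, the germs of $g^n_i$ and $g^n_{i'}$ differ by a coboundary in $C^\infty_{loc}(G^n,A)$. 4. There is one and only one group homomorphism $H^n_{diff}(G,A)\to H^n_{loc}(G,A)$ such that, for every simplicial family of open sets (in particular every simplicial open covering), whenever a Čech cocycle $g=(g^0,\dots,g^n)$ represents $x$ and $i\in J_n$ is distinguished, $x$ is sent to the class of the germ at $1$ of $g^n_i$. -/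

import Mathlib

open CategoryTheory Opposite TopologicalSpace Set Filter
open scoped Topology

universe u v w

set_option linter.unusedSectionVars false

namespace DiffCoh

section Calculus

/-- A Fréchet space: a real Hausdorff locally convex topological vector space which is first
countable (equivalently, metrizable) and complete. -/
class FrechetSpace (E : Type*) [AddCommGroup E] [Module ℝ E] [TopologicalSpace E] : Prop where
  topologicalAddGroup : IsTopologicalAddGroup E
  continuousSMul : ContinuousSMul ℝ E
  locallyConvex : LocallyConvexSpace ℝ E
  t2 : T2Space E
  firstCountable : FirstCountableTopology E
  complete : ∀ x : ℕ → E, Tendsto (fun p : ℕ × ℕ => x p.1 - x p.2) atTop (𝓝 0) →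
    ∃ l, Tendsto x atTop (𝓝 l)

attribute [instance] FrechetSpace.topologicalAddGroup FrechetSpace.continuousSMul
  FrechetSpace.locallyConvex FrechetSpace.t2

instance {E F : Type*} [AddCommGroup E] [Module ℝ E] [TopologicalSpace E] [FrechetSpace E]
    [AddCommGroup F] [Module ℝ F] [TopologicalSpace F] [FrechetSpace F] : FrechetSpace (E × F) where
  topologicalAddGroup := inferInstance
  continuousSMul := inferInstance
  locallyConvex := inferInstance
  t2 := inferInstance
  firstCountable :=
    have := FrechetSpace.firstCountable (E := E)
    have := FrechetSpace.firstCountable (E := F)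
    inferInstance
  complete x hx := by
    obtain ⟨a, ha⟩ := FrechetSpace.complete (fun n => (x n).1) ((continuous_fst.tendsto 0).comp hx)
    obtain ⟨b, hb⟩ := FrechetSpace.complete (fun n => (x n).2) ((continuous_snd.tendsto 0).comp hx)
    exact ⟨(a, b), ha.prodMk_nhds hb⟩

instance {E : Type*} [AddCommGroup E] [Module ℝ E] [TopologicalSpace E] [FrechetSpace E] (n : ℕ) :
    FrechetSpace (Fin n → E) where
  topologicalAddGroup := inferInstance
  continuousSMul := inferInstance
  locallyConvex := inferInstance
  t2 := inferInstance
  firstCountable :=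
    have := FrechetSpace.firstCountable (E := E)
    inferInstance
  complete x hx := by
    choose a ha using fun i => FrechetSpace.complete (fun n => x n i)
      (((continuous_apply i).tendsto 0).comp hx)
    exact ⟨a, tendsto_pi_nhds.2 ha⟩

/-- `f` has directional derivative `L` at `x` in the direction `v`. -/
def HasDirDeriv {E : Type u} {F : Type v} [AddCommGroup E] [Module ℝ E]
    [AddCommGroup F] [Module ℝ F] [TopologicalSpace F] (f : E → F) (L : F) (x v : E) : Prop :=
  Tendsto (fun t : ℝ => t⁻¹ • (f (x + t • v) - f x)) (𝓝[≠] 0) (𝓝 L)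

open Classical in
/-- The directional derivative (`0` if it does not exist). -/
noncomputable def dirDeriv {E : Type u} {F : Type v} [AddCommGroup E] [Module ℝ E]
    [AddCommGroup F] [Module ℝ F] [TopologicalSpace F] (f : E → F) (x v : E) : F :=
  if h : ∃ L, HasDirDeriv f L x v then h.choose else 0

/-- `C^k` maps on an open subset `U` of a topological vector space (Michal-Bastiani calculus, also
used by Hamilton and Milnor): `f` is `C^0` if it is continuous, and `C^(k+1)` if it is continuous,
all directional derivatives `df(x,v)` exist at points `x ∈ U`, and `df : U × E → F` is `C^k`. -/
def CkOn {F : Type v} [AddCommGroup F] [Module ℝ F] [TopologicalSpace F] :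
    ℕ → ∀ {E : Type u} [AddCommGroup E] [Module ℝ E] [TopologicalSpace E],
      (E → F) → Set E → Prop
  | 0, _, _, _, _, f, U => ContinuousOn f U
  | k + 1, _, _, _, _, f, U => ContinuousOn f U ∧ (∀ x ∈ U, ∀ v, ∃ L, HasDirDeriv f L x v) ∧
      CkOn k (fun p => dirDeriv f p.1 p.2) (U ×ˢ univ)

/-- `C^∞` maps on an open subset of a topological vector space. -/
def SmoothOn {E : Type u} {F : Type v} [AddCommGroup E] [Module ℝ E] [TopologicalSpace E]
    [AddCommGroup F] [Module ℝ F] [TopologicalSpace F] (f : E → F) (U : Set E) : Prop :=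
  ∀ k, CkOn k f U

variable {E : Type*} [AddCommGroup E] [Module ℝ E] [TopologicalSpace E]
  {F : Type*} [AddCommGroup F] [Module ℝ F] [TopologicalSpace F]
  {H : Type*} [AddCommGroup H] [Module ℝ H] [TopologicalSpace H]

theorem HasDirDeriv.eq [T2Space F] {f : E → F} {L : F} {x v : E} (h : HasDirDeriv f L x v) :
    dirDeriv f x v = L := by
  have h' : ∃ L, HasDirDeriv f L x v := ⟨L, h⟩
  rw [dirDeriv, dif_pos h']
  exact tendsto_nhds_unique h'.choose_spec h

theorem hasDirDeriv_dirDeriv {f : E → F} {x v : E} (h : ∃ L, HasDirDeriv f L x v) :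
    HasDirDeriv f (dirDeriv f x v) x v := by
  rw [dirDeriv, dif_pos h]; exact h.choose_spec

theorem CkOn.continuousOn {k : ℕ} {f : E → F} {U : Set E} (h : CkOn k f U) :
    ContinuousOn f U := by
  cases k with
  | zero => exact h
  | succ k => exact h.1

theorem tendsto_line [ContinuousAdd E] [ContinuousSMul ℝ E] (x v : E) :
    Tendsto (fun t : ℝ => x + t • v) (𝓝 0) (𝓝 x) := by
  have : Continuous (fun t : ℝ => x + t • v) := by fun_prop
  simpa using this.tendsto 0

theorem HasDirDeriv.congr [ContinuousAdd E] [ContinuousSMul ℝ E] {f g : E → F} {U : Set E}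
    (hU : IsOpen U) (hfg : EqOn f g U) {L : F} {x v : E} (hx : x ∈ U) (h : HasDirDeriv f L x v) :
    HasDirDeriv g L x v := by
  refine Tendsto.congr' ?_ h
  have h1 : ∀ᶠ t in 𝓝[≠] (0 : ℝ), x + t • v ∈ U :=
    ((tendsto_line x v).mono_left nhdsWithin_le_nhds).eventually (hU.mem_nhds hx)
  filter_upwards [h1] with t ht
  rw [hfg ht, hfg hx]

theorem CkOn.congr {k : ℕ} [T2Space F] :
    ∀ {E : Type u} [AddCommGroup E] [Module ℝ E] [TopologicalSpace E] [ContinuousAdd E]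
      [ContinuousSMul ℝ E] {f g : E → F} {U : Set E}, IsOpen U → EqOn f g U →
      CkOn k f U → CkOn k g U := by
  induction k with
  | zero => intro E _ _ _ _ _ f g U _ hfg h; exact ContinuousOn.congr h hfg.symm
  | succ k ih =>
    intro E _ _ _ _ _ f g U hU hfg h
    refine ⟨h.1.congr hfg.symm, fun x hx v => ?_, ?_⟩
    · obtain ⟨L, hL⟩ := h.2.1 x hx v
      exact ⟨L, hL.congr hU hfg hx⟩
    · refine ih (hU.prod isOpen_univ) ?_ h.2.2
      rintro ⟨x, v⟩ ⟨hx, -⟩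
      exact ((hasDirDeriv_dirDeriv (h.2.1 x hx v)).congr hU hfg hx).eq.symm

theorem CkOn.mono {k : ℕ} :
    ∀ {E : Type u} [AddCommGroup E] [Module ℝ E] [TopologicalSpace E] {f : E → F} {U V : Set E},
      V ⊆ U → CkOn k f U → CkOn k f V := by
  induction k with
  | zero => intro E _ _ _ f U V hV h; exact ContinuousOn.mono h hV
  | succ k ih =>
    intro E _ _ _ f U V hV h
    exact ⟨h.1.mono hV, fun x hx => h.2.1 x (hV hx), ih (prod_mono_left hV) h.2.2⟩

theorem CkOn.of_local {k : ℕ} :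
    ∀ {E : Type u} [AddCommGroup E] [Module ℝ E] [TopologicalSpace E] {f : E → F} {U : Set E},
      (∀ x ∈ U, ∃ V, IsOpen V ∧ x ∈ V ∧ CkOn k f (U ∩ V)) → CkOn k f U := by
  induction k with
  | zero =>
    intro E _ _ _ f U h x hx
    obtain ⟨V, hV, hxV, h⟩ := h x hx
    exact (continuousWithinAt_inter (hV.mem_nhds hxV)).1 (ContinuousOn.continuousWithinAt h ⟨hx, hxV⟩)
  | succ k ih =>
    intro E _ _ _ f U h
    refine ⟨fun x hx => ?_, fun x hx v => ?_, ih ?_⟩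
    · obtain ⟨V, hV, hxV, h⟩ := h x hx
      exact (continuousWithinAt_inter (hV.mem_nhds hxV)).1 (h.1 x ⟨hx, hxV⟩)
    · obtain ⟨V, hV, hxV, h⟩ := h x hx
      exact h.2.1 x ⟨hx, hxV⟩ v
    · rintro ⟨x, v⟩ ⟨hx, -⟩
      obtain ⟨V, hV, hxV, h⟩ := h x hx
      refine ⟨V ×ˢ univ, hV.prod isOpen_univ, ⟨hxV, mem_univ _⟩, ?_⟩
      rw [prod_inter_prod, univ_inter]
      exact h.2.2

theorem CkOn.of_succ {k : ℕ} :
    ∀ {E : Type u} [AddCommGroup E] [Module ℝ E] [TopologicalSpace E] {f : E → F} {U : Set E},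
      CkOn (k + 1) f U → CkOn k f U := by
  induction k with
  | zero => intro E _ _ _ f U h; exact h.1
  | succ k ih => intro E _ _ _ f U h; exact ⟨h.1, h.2.1, ih h.2.2⟩

theorem CkOn.comp_linear {k : ℕ} [T2Space F] :
    ∀ {E E' : Type u} [AddCommGroup E] [Module ℝ E] [TopologicalSpace E] [ContinuousAdd E]
      [ContinuousSMul ℝ E] [AddCommGroup E'] [Module ℝ E'] [TopologicalSpace E']
      [ContinuousAdd E'] [ContinuousSMul ℝ E'] {f : E → F} {U : Set E} (l : E' →L[ℝ] E),
      IsOpen U → CkOn k f U → CkOn k (f ∘ l) (l ⁻¹' U) := by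
  induction k with
  | zero =>
    intro E E' _ _ _ _ _ _ _ _ _ _ f U l _ h
    exact ContinuousOn.comp h l.continuous.continuousOn (mapsTo_preimage _ _)
  | succ k ih =>
    intro E E' _ _ _ _ _ _ _ _ _ _ f U l hU h
    have key : ∀ x ∈ l ⁻¹' U, ∀ v, HasDirDeriv (f ∘ l) (dirDeriv f (l x) (l v)) x v := by
      intro x hx v
      have := hasDirDeriv_dirDeriv (h.2.1 (l x) hx (l v))
      simpa [HasDirDeriv] using this
    refine ⟨h.1.comp l.continuous.continuousOn (mapsTo_preimage _ _),
      fun x hx v => ⟨_, key x hx v⟩, ?_⟩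
    have h2 := ih (l.prodMap l) (hU.prod isOpen_univ) h.2.2
    refine h2.congr ((hU.prod isOpen_univ).preimage (l.prodMap l).continuous) ?_ |>.mono ?_
    · rintro ⟨x, v⟩ ⟨hx, -⟩
      exact (key x hx v).eq.symm
    · rintro ⟨x, v⟩ ⟨hx, -⟩
      exact ⟨hx, mem_univ _⟩

theorem ckOn_linear {k : ℕ} [T2Space F] :
    ∀ {E : Type u} [AddCommGroup E] [Module ℝ E] [TopologicalSpace E] [ContinuousAdd E]
      [ContinuousSMul ℝ E] (l : E →L[ℝ] F), CkOn k l univ := by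
  induction k with
  | zero => intro E _ _ _ _ _ l; exact l.continuous.continuousOn
  | succ k ih =>
    intro E _ _ _ _ _ l
    have key : ∀ x v, HasDirDeriv l (l v) x v := by
      intro x v
      refine Tendsto.congr' ?_ tendsto_const_nhds
      filter_upwards [self_mem_nhdsWithin] with t ht
      have ht : t ≠ 0 := ht
      simp [smul_smul, inv_mul_cancel₀ ht]
    refine ⟨l.continuous.continuousOn, fun x _ v => ⟨_, key x v⟩, ?_⟩
    rw [univ_prod_univ]
    refine (ih (l.comp (ContinuousLinearMap.snd ℝ E E))).congr isOpen_univ ?_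
    rintro ⟨x, v⟩ -
    exact (key x v).eq.symm

theorem CkOn.prodMk {k : ℕ} [T2Space F] [T2Space H] :
    ∀ {E : Type u} [AddCommGroup E] [Module ℝ E] [TopologicalSpace E] [ContinuousAdd E]
      [ContinuousSMul ℝ E] {f : E → F} {g : E → H} {U : Set E}, IsOpen U →
      CkOn k f U → CkOn k g U → CkOn k (fun x => (f x, g x)) U := by
  induction k with
  | zero => intro E _ _ _ _ _ f g U _ hf hg; exact ContinuousOn.prodMk hf hg
  | succ k ih =>
    intro E _ _ _ _ _ f g U hU hf hg
    have key : ∀ x ∈ U, ∀ v,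
        HasDirDeriv (fun x => (f x, g x)) (dirDeriv f x v, dirDeriv g x v) x v := fun x hx v =>
      (hasDirDeriv_dirDeriv (hf.2.1 x hx v)).prodMk_nhds (hasDirDeriv_dirDeriv (hg.2.1 x hx v))
    refine ⟨hf.1.prodMk hg.1, fun x hx v => ⟨_, key x hx v⟩, ?_⟩
    refine (ih (hU.prod isOpen_univ) hf.2.2 hg.2.2).congr (hU.prod isOpen_univ) ?_
    rintro ⟨x, v⟩ ⟨hx, -⟩
    exact (key x hx v).eq.symm

theorem CkOn.pi {k : ℕ} {ι : Type*} {F : ι → Type*} [∀ i, AddCommGroup (F i)]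
    [∀ i, Module ℝ (F i)] [∀ i, TopologicalSpace (F i)] [∀ i, T2Space (F i)] :
    ∀ {E : Type u} [AddCommGroup E] [Module ℝ E] [TopologicalSpace E] [ContinuousAdd E]
      [ContinuousSMul ℝ E] {f : ∀ i, E → F i} {U : Set E}, IsOpen U →
      (∀ i, CkOn k (f i) U) → CkOn k (fun x i => f i x) U := by
  induction k with
  | zero => intro E _ _ _ _ _ f U _ hf; exact continuousOn_pi.2 hf
  | succ k ih =>
    intro E _ _ _ _ _ f U hU hf
    have key : ∀ x ∈ U, ∀ v,
        HasDirDeriv (fun x i => f i x) (fun i => dirDeriv (f i) x v) x v := fun x hx v =>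
      tendsto_pi_nhds.2 fun i => hasDirDeriv_dirDeriv ((hf i).2.1 x hx v)
    refine ⟨continuousOn_pi.2 fun i => (hf i).1, fun x hx v => ⟨_, key x hx v⟩, ?_⟩
    refine (ih (hU.prod isOpen_univ) fun i => (hf i).2.2).congr (hU.prod isOpen_univ) ?_
    rintro ⟨x, v⟩ ⟨hx, -⟩
    exact (key x hx v).eq.symm

/-- Mean value estimate in a locally convex space. -/
theorem sub_mem_of_deriv_mem [IsTopologicalAddGroup F] [ContinuousSMul ℝ F]
    [LocallyConvexSpace ℝ F] {C : Set F} (hC : Convex ℝ C) (hCc : IsClosed C)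
    {φ φ' : ℝ → F} (h : ∀ s ∈ Icc (0 : ℝ) 1, HasDirDeriv φ (φ' s) s 1)
    (hφ' : ∀ s ∈ Icc (0 : ℝ) 1, φ' s ∈ C) : φ 1 - φ 0 ∈ C := by
  by_contra hn
  obtain ⟨l, r, hl, hr⟩ := geometric_hahn_banach_closed_point hC hCc hn
  have hd : ∀ s ∈ Icc (0 : ℝ) 1, HasDerivAt (fun s => l (φ s)) (l (φ' s)) s := by
    intro s hs
    rw [hasDerivAt_iff_tendsto_slope_zero]
    have := (l.continuous.tendsto _).comp (h s hs)
    refine this.congr fun t => ?_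
    simp
  have hmv : l (φ 1) - l (φ 0) ≤ r := by
    have := Convex.image_sub_le_mul_sub_of_deriv_le (convex_Icc (0 : ℝ) 1)
      (f := fun s => l (φ s)) (fun s hs => (hd s hs).continuousAt.continuousWithinAt)
      (fun s hs => (hd s (interior_subset hs)).differentiableAt.differentiableWithinAt)
      (C := r) (fun s hs => by
        rw [(hd s (interior_subset hs)).deriv]
        exact (hl _ (hφ' s (interior_subset hs))).le) 0 (by simp) 1 (by simp) zero_le_one
    simpa using this
  rw [map_sub] at hr
  linarith

/-- The chain rule for directional derivatives of `C^1` maps. -/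
theorem hasDirDeriv_comp [ContinuousAdd E] [ContinuousSMul ℝ E]
    [IsTopologicalAddGroup F] [ContinuousSMul ℝ F]
    [IsTopologicalAddGroup H] [ContinuousSMul ℝ H] [LocallyConvexSpace ℝ H]
    {f : E → F} {g : F → H} {V : Set F} (hV : IsOpen V) {x v : E} {y' : F}
    (hf : HasDirDeriv f y' x v) (hx : f x ∈ V)
    (hg : ∀ y ∈ V, ∀ w, ∃ L, HasDirDeriv g L y w)
    (hg' : ContinuousOn (fun p : F × F => dirDeriv g p.1 p.2) (V ×ˢ univ)) :
    HasDirDeriv (g ∘ f) (dirDeriv g (f x) y') x v := by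
  set y := f x with hy
  set q : ℝ → F := fun t => t⁻¹ • (f (x + t • v) - f x) with hq
  have hqt : Tendsto q (𝓝[≠] 0) (𝓝 y') := hf
  have hdiff : ∀ t : ℝ, t ≠ 0 → f (x + t • v) = y + t • q t := by
    intro t ht
    simp [hq, hy, smul_smul, mul_inv_cancel₀ ht]
  intro N hN
  obtain ⟨C₀, hC₀, hC₀c, hC₀N⟩ := exists_mem_nhds_isClosed_subset hN
  obtain ⟨C₁, ⟨hC₁, hC₁v⟩, hC₁C₀⟩ :=
    (LocallyConvexSpace.convex_basis (𝕜 := ℝ) (dirDeriv g y y')).mem_iff.1 hC₀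
  have hCN : closure C₁ ⊆ N := (closure_minimal hC₁C₀ hC₀c).trans hC₀N
  have hev : ∀ᶠ p : F × F in 𝓝 (y, y'), p.1 ∈ V ∧ dirDeriv g p.1 p.2 ∈ C₁ := by
    have hmem : V ×ˢ (univ : Set F) ∈ 𝓝 (y, y') :=
      (hV.prod isOpen_univ).mem_nhds ⟨hx, mem_univ _⟩
    have h1 := (hg'.continuousAt hmem).eventually_mem hC₁
    filter_upwards [hmem, h1] with p hp hp'
    exact ⟨hp.1, hp'⟩
  have hcont : Continuous (fun p : ℝ × F => (y + p.1 • p.2, p.2)) := by fun_prop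
  have hev2 : ∀ᶠ p : ℝ × F in 𝓝 0 ×ˢ 𝓝 y',
      y + p.1 • p.2 ∈ V ∧ dirDeriv g (y + p.1 • p.2) p.2 ∈ C₁ := by
    rw [← nhds_prod_eq]
    have := hcont.tendsto (0, y')
    simp only [zero_smul, add_zero] at this
    exact this.eventually hev
  obtain ⟨P, hP, Q, hQ, hPQ⟩ := eventually_prod_iff.1 hev2
  obtain ⟨δ, hδ, hPδ⟩ := Metric.eventually_nhds_iff.1 hP
  have hsmall : ∀ᶠ t in 𝓝[≠] (0 : ℝ), dist t 0 < δ :=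
    nhdsWithin_le_nhds (Metric.ball_mem_nhds 0 hδ)
  have hne : ∀ᶠ t in 𝓝[≠] (0 : ℝ), t ≠ 0 := self_mem_nhdsWithin
  have hQt := hqt.eventually hQ
  change ∀ᶠ t in 𝓝[≠] (0 : ℝ), _ ∈ N
  filter_upwards [hsmall, hne, hQt] with t ht1 ht0 htQ
  apply hCN
  have hs : ∀ s ∈ Icc (0 : ℝ) 1, P (s * t) := by
    intro s hs
    apply hPδ
    refine lt_of_le_of_lt ?_ ht1
    rw [dist_zero_right, dist_zero_right, norm_mul]
    exact mul_le_of_le_one_left (norm_nonneg _) (by rw [Real.norm_eq_abs, abs_of_nonneg hs.1]; exact hs.2)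
  have hmv := sub_mem_of_deriv_mem (C := closure C₁) hC₁v.closure isClosed_closure
    (φ := fun s => t⁻¹ • g (y + (s * t) • q t))
    (φ' := fun s => dirDeriv g (y + (s * t) • q t) (q t)) ?_ ?_
  · simpa [hdiff t ht0, ← hy, smul_sub] using hmv
  · intro s hs'
    have h1 := hasDirDeriv_dirDeriv (hg _ (hPQ (hs s hs') htQ).1 (q t))
    have hlim : Tendsto (fun τ : ℝ => τ * t) (𝓝[≠] 0) (𝓝[≠] 0) := by
      refine tendsto_nhdsWithin_iff.2 ⟨?_, ?_⟩
      · have : Continuous (fun τ : ℝ => τ * t) := by fun_prop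
        simpa using (this.tendsto 0).mono_left nhdsWithin_le_nhds
      · filter_upwards [self_mem_nhdsWithin] with τ hτ
        exact mul_ne_zero hτ ht0
    refine (h1.comp hlim).congr fun τ => ?_
    simp only [Function.comp_apply, smul_eq_mul, mul_one, mul_inv, ← smul_sub, smul_smul,
      add_mul, add_smul, add_assoc]
  · intro s hs'
    exact subset_closure (hPQ (hs s hs') htQ).2

theorem CkOn.comp {k : ℕ} [IsTopologicalAddGroup H] [ContinuousSMul ℝ H] [LocallyConvexSpace ℝ H]
    [T2Space H] :
    ∀ {E : Type u} [AddCommGroup E] [Module ℝ E] [TopologicalSpace E] [ContinuousAdd E]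
      [ContinuousSMul ℝ E] {F : Type v} [AddCommGroup F] [Module ℝ F] [TopologicalSpace F]
      [IsTopologicalAddGroup F] [ContinuousSMul ℝ F] [T2Space F]
      {f : E → F} {g : F → H} {U : Set E} {V : Set F}, IsOpen U → IsOpen V → MapsTo f U V →
      CkOn k g V → CkOn k f U → CkOn k (g ∘ f) U := by
  induction k with
  | zero => intro E _ _ _ _ _ F _ _ _ _ _ _ f g U V _ _ hm hg hf; exact ContinuousOn.comp hg hf hm
  | succ k ih =>
    intro E _ _ _ _ _ F _ _ _ _ _ _ f g U V hU hV hm hg hf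
    have key : ∀ x ∈ U, ∀ v,
        HasDirDeriv (g ∘ f) (dirDeriv g (f x) (dirDeriv f x v)) x v := fun x hx v =>
      hasDirDeriv_comp hV (hasDirDeriv_dirDeriv (hf.2.1 x hx v)) (hm hx) hg.2.1
        hg.2.2.continuousOn
    refine ⟨hg.1.comp hf.1 hm, fun x hx v => ⟨_, key x hx v⟩, ?_⟩
    have hUU : IsOpen (U ×ˢ (univ : Set E)) := hU.prod isOpen_univ
    have h1 : CkOn k (fun p : E × E => f p.1) (U ×ˢ univ) :=
      (hf.of_succ.comp_linear (ContinuousLinearMap.fst ℝ E E) hU).mono fun p hp => hp.1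
    have h2 := ih (U := U ×ˢ (univ : Set E)) hUU (hV.prod isOpen_univ)
      (fun p hp => ⟨hm hp.1, mem_univ _⟩) hg.2.2 (h1.prodMk hUU hf.2.2)
    refine h2.congr hUU ?_
    rintro ⟨x, v⟩ ⟨hx, -⟩
    exact (key x hx v).eq.symm

end Calculus

section Manifolds

/-- The product manifold structure on `M × N`. -/
instance prodCharted {E F M N : Type*} [TopologicalSpace E] [TopologicalSpace F]
    [TopologicalSpace M] [TopologicalSpace N] [ChartedSpace E M] [ChartedSpace F N] :
    ChartedSpace (E × F) (M × N) :=
  inferInstanceAs (ChartedSpace (ModelProd E F) (M × N))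

/-- The product manifold structure on `M ^ n`. -/
instance powCharted {E M : Type*} [TopologicalSpace E] [TopologicalSpace M] [ChartedSpace E M]
    (n : ℕ) : ChartedSpace (Fin n → E) (Fin n → M) :=
  inferInstanceAs (ChartedSpace (ModelPi fun _ : Fin n => E) (Fin n → M))

/-- All transition maps between charts of the atlas of `M` are smooth. -/
class SmoothAtlas (E : Type*) [AddCommGroup E] [Module ℝ E] [TopologicalSpace E]
    (M : Type*) [TopologicalSpace M] [ChartedSpace E M] : Prop where
  smooth_transition : ∀ e ∈ atlas E M, ∀ e' ∈ atlas E M,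
    SmoothOn (e' ∘ e.symm) (e.symm.trans e').source

/-- `f : M → N` is smooth on the open set `U ⊆ M`: it is continuous on `U` and smooth there in all
charts of the atlases. -/
def MSmoothOn (E F : Type*) [AddCommGroup E] [Module ℝ E] [TopologicalSpace E]
    [AddCommGroup F] [Module ℝ F] [TopologicalSpace F] {M N : Type*} [TopologicalSpace M]
    [ChartedSpace E M] [TopologicalSpace N] [ChartedSpace F N] (f : M → N) (U : Set M) : Prop :=
  ContinuousOn f U ∧ ∀ e ∈ atlas E M, ∀ e' ∈ atlas F N,
    SmoothOn (e' ∘ f ∘ e.symm) (e.target ∩ e.symm ⁻¹' (U ∩ f ⁻¹' e'.source))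

variable {E : Type*} [AddCommGroup E] [Module ℝ E] [TopologicalSpace E] [FrechetSpace E]
  {F : Type*} [AddCommGroup F] [Module ℝ F] [TopologicalSpace F] [FrechetSpace F]
  {H : Type*} [AddCommGroup H] [Module ℝ H] [TopologicalSpace H] [FrechetSpace H]
  {M : Type*} [TopologicalSpace M] [ChartedSpace E M]
  {N : Type*} [TopologicalSpace N] [ChartedSpace F N]
  {P : Type*} [TopologicalSpace P] [ChartedSpace H P]

theorem MSmoothOn.mono {f : M → N} {U V : Set M} (h : MSmoothOn E F f U) (hV : V ⊆ U) :
    MSmoothOn E F f V :=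
  ⟨h.1.mono hV, fun e he e' he' k => CkOn.mono
    (inter_subset_inter_right _ (preimage_mono (inter_subset_inter_left _ hV)))
    (h.2 e he e' he' k)⟩

theorem isOpen_chart_set {f : M → N} {U : Set M} (hU : IsOpen U) (hf : ContinuousOn f U)
    (e : OpenPartialHomeomorph M E) (e' : OpenPartialHomeomorph N F) :
    IsOpen (e.target ∩ e.symm ⁻¹' (U ∩ f ⁻¹' e'.source)) :=
  e.isOpen_inter_preimage_symm (hf.isOpen_inter_preimage hU e'.open_source)

theorem MSmoothOn.congr {f g : M → N} {U : Set M} (h : MSmoothOn E F f U) (hU : IsOpen U)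
    (hfg : EqOn f g U) : MSmoothOn E F g U := by
  refine ⟨h.1.congr hfg.symm, fun e he e' he' k => ?_⟩
  refine ((h.2 e he e' he' k).congr (isOpen_chart_set hU h.1 e e') ?_).mono ?_
  · rintro x ⟨-, hx, -⟩
    simp [hfg hx]
  · rintro x ⟨hx1, hx2, hx3⟩
    refine ⟨hx1, hx2, ?_⟩
    simpa [hfg hx2] using hx3

theorem MSmoothOn.of_local {f : M → N} {U : Set M}
    (h : ∀ x ∈ U, ∃ V, IsOpen V ∧ x ∈ V ∧ MSmoothOn E F f (U ∩ V)) : MSmoothOn E F f U := by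
  refine ⟨fun x hx => ?_, fun e he e' he' k => CkOn.of_local fun x hx => ?_⟩
  · obtain ⟨V, hV, hxV, h⟩ := h x hx
    exact (continuousWithinAt_inter (hV.mem_nhds hxV)).1 (h.1 x ⟨hx, hxV⟩)
  · obtain ⟨V, hV, hxV, h⟩ := h _ hx.2.1
    refine ⟨e.target ∩ e.symm ⁻¹' V, e.isOpen_inter_preimage_symm hV, ⟨hx.1, hxV⟩, ?_⟩
    refine (h.2 e he e' he' k).mono ?_
    rintro y ⟨⟨h1, h2, h3⟩, -, h4⟩
    exact ⟨h1, ⟨h2, h4⟩, h3⟩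

theorem MSmoothOn.comp {f : M → N} {g : N → P} {U : Set M} {V : Set N}
    (hg : MSmoothOn F H g V) (hf : MSmoothOn E F f U) (hU : IsOpen U) (hV : IsOpen V)
    (hm : MapsTo f U V) : MSmoothOn E H (g ∘ f) U := by
  refine ⟨hg.1.comp hf.1 hm, fun e he e' he' k => CkOn.of_local fun x hx => ?_⟩
  set c := chartAt F (f (e.symm x)) with hc
  have hca := chart_mem_atlas F (f (e.symm x))
  refine ⟨e.target ∩ e.symm ⁻¹' (U ∩ f ⁻¹' c.source), isOpen_chart_set hU hf.1 e c,
    ⟨hx.1, hx.2.1, mem_chart_source F _⟩, ?_⟩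
  have hgf : ContinuousOn (g ∘ f) U := hg.1.comp hf.1 hm
  have hopen := (isOpen_chart_set hU hgf e e').inter (isOpen_chart_set hU hf.1 e c)
  have h1 := (hf.2 e he c hca k).mono (V := (e.target ∩ e.symm ⁻¹' (U ∩ (g ∘ f) ⁻¹' e'.source)) ∩
    (e.target ∩ e.symm ⁻¹' (U ∩ f ⁻¹' c.source))) inter_subset_right
  have h2 := hg.2 c hca e' he' k
  refine (CkOn.comp hopen (isOpen_chart_set hV hg.1 c e') ?_ h2 h1).congr hopen ?_
  · rintro y ⟨⟨-, -, hy1⟩, -, hy2, hy3⟩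
    have hy3 : f (e.symm y) ∈ c.source := hy3
    refine ⟨c.map_source hy3, ?_⟩
    simp only [Function.comp_apply, mem_preimage, c.left_inv hy3]
    exact ⟨hm hy2, hy1⟩
  · rintro y ⟨-, -, -, hy3⟩
    have hy3 : f (e.symm y) ∈ c.source := hy3
    simp [c.left_inv hy3]

theorem MSmoothOn.prodMk {f : M → N} {g : M → P} {U : Set M} (hU : IsOpen U)
    (hf : MSmoothOn E F f U) (hg : MSmoothOn E H g U) :
    MSmoothOn E (F × H) (fun x => (f x, g x)) U := by
  refine ⟨hf.1.prodMk hg.1, fun e he e' he' k => ?_⟩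
  obtain ⟨a, ha, b, hb, rfl⟩ := he'
  have ho := (isOpen_chart_set hU hf.1 e a).inter (isOpen_chart_set hU hg.1 e b)
  refine (CkOn.prodMk ho ((hf.2 e he a ha k).mono inter_subset_left)
    ((hg.2 e he b hb k).mono inter_subset_right)).mono ?_
  rintro x ⟨h1, h2, h3, h4⟩
  exact ⟨⟨h1, h2, h3⟩, h1, h2, h4⟩

theorem MSmoothOn.pi {n : ℕ} {f : Fin n → M → N} {U : Set M} (hU : IsOpen U)
    (hf : ∀ i, MSmoothOn E F (f i) U) :
    MSmoothOn E (Fin n → F) (fun x i => f i x) U := by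
  refine ⟨continuousOn_pi.2 fun i => (hf i).1, fun e he e' he' k => ?_⟩
  obtain ⟨a, ha, rfl⟩ := he'
  by_cases hn : Nonempty (Fin n)
  · have ho : IsOpen (⋂ i, e.target ∩ e.symm ⁻¹' (U ∩ f i ⁻¹' (a i).source)) :=
      isOpen_iInter_of_finite fun i => isOpen_chart_set hU (hf i).1 e (a i)
    refine (CkOn.pi ho fun i =>
      ((hf i).2 e he (a i) (ha i (mem_univ i)) k).mono (iInter_subset _ i)).mono ?_
    rintro x ⟨h1, h2, h3⟩
    exact mem_iInter.2 fun i => ⟨h1, h2, h3 i (mem_univ i)⟩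
  · have : IsEmpty (Fin n) := not_nonempty_iff.1 hn
    refine (CkOn.pi (U := univ) isOpen_univ fun i => isEmptyElim i).mono (subset_univ _)

theorem msmoothOn_proj [SmoothAtlas E M] {n : ℕ} (i : Fin n) (U : Set (Fin n → M)) :
    MSmoothOn (Fin n → E) E (fun x : Fin n → M => x i) U := by
  refine ⟨(continuous_apply i).continuousOn, fun e he e' he' k => ?_⟩
  obtain ⟨a, ha, rfl⟩ := he
  have h := SmoothAtlas.smooth_transition (a i) (ha i (mem_univ i)) e' he' k
  refine (h.comp_linear (ContinuousLinearMap.proj (R := ℝ) (φ := fun _ : Fin n => E) i)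
    ((a i).symm.trans e').open_source).mono ?_
  rintro x ⟨h1, h2, h3⟩
  have h1' : ∀ j ∈ univ, x j ∈ (a j).target := h1
  refine ⟨h1' i (mem_univ i), h3⟩

theorem ckOn_const (k : ℕ) (c : F) :
    ∀ {E : Type u} [AddCommGroup E] [Module ℝ E] [TopologicalSpace E] (U : Set E),
      CkOn k (fun _ : E => c) U := by
  induction k generalizing c with
  | zero => intro E _ _ _ U; exact continuousOn_const
  | succ k ih =>
    intro E _ _ _ U
    have key : ∀ x v : E, HasDirDeriv (fun _ : E => c) (0 : F) x v := fun x v => by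
      simp [HasDirDeriv]
    refine ⟨continuousOn_const, fun x _ v => ⟨0, key x v⟩, ?_⟩
    have : (fun p : E × E => dirDeriv (fun _ : E => c) p.1 p.2) = fun _ => 0 :=
      funext fun p => (key p.1 p.2).eq
    rw [this]
    exact ih 0 _

theorem msmoothOn_const (c : N) (U : Set M) : MSmoothOn E F (fun _ : M => c) U :=
  ⟨continuousOn_const, fun _ _ e' _ k => ckOn_const k (e' c) _⟩

end Manifolds

section LieGroups

/-- A (possibly infinite-dimensional) Lie group modelled on the Fréchet space `E`: a paracompact
Hausdorff Fréchet manifold which is a group with smooth multiplication and inversion. -/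
class FrechetLieGroup (E : Type*) [AddCommGroup E] [Module ℝ E] [TopologicalSpace E]
    (G : Type*) [Group G] [TopologicalSpace G] [IsTopologicalGroup G] [ChartedSpace E G] : Prop
    extends SmoothAtlas E G where
  t2 : T2Space G
  paracompact : ParacompactSpace G
  smooth_mul : MSmoothOn (E × E) E (fun p : G × G => p.1 * p.2) univ
  smooth_inv : MSmoothOn E E (fun g : G => g⁻¹) univ

/-- An abelian Lie group, written additively, modelled on the Fréchet space `E`. -/
class FrechetAddLieGroup (E : Type*) [AddCommGroup E] [Module ℝ E] [TopologicalSpace E]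
    (A : Type*) [AddCommGroup A] [TopologicalSpace A] [IsTopologicalAddGroup A]
    [ChartedSpace E A] : Prop extends SmoothAtlas E A where
  t2 : T2Space A
  paracompact : ParacompactSpace A
  smooth_add : MSmoothOn (E × E) E (fun p : A × A => p.1 + p.2) univ
  smooth_neg : MSmoothOn E E (fun a : A => -a) univ

/-- `A` is a differentiable `G`-module: the action map `G × A → A` is smooth. -/
class SmoothAction (E EA : Type*) [AddCommGroup E] [Module ℝ E] [TopologicalSpace E]
    [AddCommGroup EA] [Module ℝ EA] [TopologicalSpace EA]
    (G A : Type*) [Group G] [TopologicalSpace G] [ChartedSpace E G]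
    [AddCommGroup A] [TopologicalSpace A] [ChartedSpace EA A] [DistribMulAction G A] : Prop where
  smooth_smul : MSmoothOn (E × EA) EA (fun p : G × A => p.1 • p.2) univ

end LieGroups

section ClassifyingSpace

variable {G : Type u} [Group G]

/-- The structure maps `G^n → G^m` of the simplicial space `BG` (the nerve of `G`): with vertices
`0, …, n` and edges `g_0, …, g_{n-1}`, the `k`-th coordinate of the image is the product of the
`g_l` with `φ(k) ≤ l < φ(k+1)`. For `φ` the `j`-th coface this is the usual face map `d_j`:
`d_0` drops `g_0`, `d_n` drops `g_{n-1}`, and otherwise `d_j` multiplies `g_{j-1}` and `g_j`. -/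
def bgMap {m n : SimplexCategory} (φ : m ⟶ n) (g : Fin n.len → G) : Fin m.len → G :=
  fun k => (Fin.partialProd g (φ.toOrderHom k.castSucc))⁻¹ *
    Fin.partialProd g (φ.toOrderHom k.succ)

theorem partialProd_bgMap {m n : SimplexCategory} (φ : m ⟶ n) (g : Fin n.len → G)
    (i : Fin (m.len + 1)) :
    Fin.partialProd (bgMap φ g) i =
      (Fin.partialProd g (φ.toOrderHom 0))⁻¹ * Fin.partialProd g (φ.toOrderHom i) := by
  induction i using Fin.induction with
  | zero => simp
  | succ i ih => rw [Fin.partialProd_succ, ih, bgMap]; group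

theorem bgMap_id (n : SimplexCategory) (g : Fin n.len → G) : bgMap (𝟙 n) g = g := by
  funext k
  simp [bgMap, Fin.partialProd_succ]

theorem bgMap_comp {l m n : SimplexCategory} (φ : l ⟶ m) (ψ : m ⟶ n) (g : Fin n.len → G) :
    bgMap (φ ≫ ψ) g = bgMap φ (bgMap ψ g) := by
  funext k
  rw [bgMap, bgMap, partialProd_bgMap, partialProd_bgMap]
  simp only [SimplexCategory.comp_toOrderHom, OrderHom.comp_coe, Function.comp_apply]
  group

theorem bgMap_one {m n : SimplexCategory} (φ : m ⟶ n) :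
    bgMap φ (1 : Fin n.len → G) = 1 := by
  have h : ∀ i, Fin.partialProd (1 : Fin n.len → G) i = 1 := fun i => by
    induction i using Fin.induction with
    | zero => simp
    | succ i ih => rw [Fin.partialProd_succ, ih]; simp
  funext k
  simp [bgMap, h]

variable [TopologicalSpace G] [IsTopologicalGroup G]

theorem continuous_partialProd {n : ℕ} (i : Fin (n + 1)) :
    Continuous fun g : Fin n → G => Fin.partialProd g i := by
  induction i using Fin.induction with
  | zero => simpa using continuous_const
  | succ i ih =>
    simp only [Fin.partialProd_succ]
    exact ih.mul (continuous_apply i)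

theorem continuous_bgMap {m n : SimplexCategory} (φ : m ⟶ n) :
    Continuous (bgMap φ : (Fin n.len → G) → Fin m.len → G) :=
  continuous_pi fun _ => (continuous_partialProd _).inv.mul (continuous_partialProd _)

/-- The objects of the site of the simplicial space `BG`: an open subset of some `G^n`. -/
@[ext]
structure BGOpen (G : Type u) [Group G] [TopologicalSpace G] : Type u where
  dim : SimplexCategory
  carrier : Opens (Fin dim.len → G)

/-- A morphism `(n, U) ⟶ (m, V)` is a simplicial operator `φ : [m] ⟶ [n]` whose structure map
`G^n → G^m` maps `U` into `V`. -/
@[ext]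
structure BGOpen.Hom (X Y : BGOpen G) : Type u where
  map : Y.dim ⟶ X.dim
  mapsTo : ∀ g ∈ X.carrier, bgMap map g ∈ Y.carrier

instance : Category.{u} (BGOpen G) where
  Hom := BGOpen.Hom
  id X := ⟨𝟙 _, fun g hg => by rwa [bgMap_id]⟩
  comp f g := ⟨g.map ≫ f.map, fun x hx => by
    rw [bgMap_comp]; exact g.mapsTo _ (f.mapsTo _ hx)⟩
  id_comp f := BGOpen.Hom.ext (Category.comp_id _)
  comp_id f := BGOpen.Hom.ext (Category.id_comp _)
  assoc f g h := BGOpen.Hom.ext (Category.assoc _ _ _).symm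

/-- The inclusion `(n, V) ⟶ (n, U)` for `V ⊆ U`. -/
def BGOpen.incl {n : SimplexCategory} {V U : Opens (Fin n.len → G)} (h : V ≤ U) :
    (⟨n, V⟩ : BGOpen G) ⟶ ⟨n, U⟩ :=
  (⟨𝟙 n, fun g hg => by rw [bgMap_id]; exact h hg⟩ : BGOpen.Hom _ _)

/-- The topology on the site of `BG`: a sieve on `(n, U)` is covering if the open subsets `V ⊆ U`
whose inclusion belongs to the sieve cover `U`. Sheaves on this site are the same as simplicial
sheaves on `BG`: sheaves `F_n` on `G^n` with a compatible system of transition morphisms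
`F_m → (bgMap φ)_* F_n`, i.e. `(bgMap φ)^* F_m → F_n`, for `φ : [m] ⟶ [n]`. -/
def bgTopology (G : Type u) [Group G] [TopologicalSpace G] [IsTopologicalGroup G] :
    GrothendieckTopology (BGOpen G) where
  sieves X := {S | ∀ x ∈ X.carrier, ∃ (V : Opens (Fin X.dim.len → G)) (h : V ≤ X.carrier),
    x ∈ V ∧ S (BGOpen.incl h : (⟨X.dim, V⟩ : BGOpen G) ⟶ X)}
  top_mem' X x hx := ⟨X.carrier, le_rfl, hx, trivial⟩
  pullback_stable' X Y S f hS y hy := by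
    obtain ⟨V, hV, hxV, hSV⟩ := hS _ (f.mapsTo y hy)
    refine ⟨Y.carrier ⊓ V.comap ⟨_, continuous_bgMap f.map⟩, inf_le_left, ⟨hy, hxV⟩, ?_⟩
    have h2 : BGOpen.incl inf_le_left ≫ f =
      (⟨f.map, fun g hg => hg.2⟩ :
        BGOpen.Hom ⟨Y.dim, Y.carrier ⊓ V.comap ⟨_, continuous_bgMap f.map⟩⟩ ⟨X.dim, V⟩) ≫
        BGOpen.incl hV := by
      apply BGOpen.Hom.ext
      exact (Category.comp_id f.map).trans (Category.id_comp f.map).symm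
    change S (_ ≫ f)
    rw [h2]
    exact S.downward_closed hSV _
  transitive' X S hS R hR x hx := by
    obtain ⟨V, hV, hxV, hSV⟩ := hS x hx
    obtain ⟨W, hW, hxW, hRW⟩ := hR hSV x hxV
    refine ⟨W, hW.trans hV, hxW, ?_⟩
    have h2 : BGOpen.incl hW ≫ BGOpen.incl hV =
        (BGOpen.incl (hW.trans hV) : (⟨X.dim, W⟩ : BGOpen G) ⟶ X) :=
      BGOpen.Hom.ext (Category.id_comp _)
    rw [← h2]
    exact hRW

end ClassifyingSpace

section Coefficients

variable (E : Type*) [AddCommGroup E] [Module ℝ E] [TopologicalSpace E] [FrechetSpace E]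
  (EA : Type*) [AddCommGroup EA] [Module ℝ EA] [TopologicalSpace EA] [FrechetSpace EA]
  (G : Type u) [Group G] [TopologicalSpace G] [IsTopologicalGroup G] [ChartedSpace E G]
  [FrechetLieGroup E G]
  (A : Type u) [AddCommGroup A] [TopologicalSpace A] [IsTopologicalAddGroup A]
  [ChartedSpace EA A] [FrechetAddLieGroup EA A] [DistribMulAction G A] [SmoothAction E EA G A]

variable {G} in
theorem msmoothOn_partialProd {n : ℕ} (i : Fin (n + 1)) (U : Set (Fin n → G)) :
    MSmoothOn (Fin n → E) E (fun g : Fin n → G => Fin.partialProd g i) U := by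
  refine MSmoothOn.mono ?_ (subset_univ U)
  induction i using Fin.induction with
  | zero => simpa using msmoothOn_const (E := Fin n → E) (F := E) (1 : G) univ
  | succ i ih =>
    simp only [Fin.partialProd_succ]
    exact (FrechetLieGroup.smooth_mul (E := E) (G := G)).comp
      (MSmoothOn.prodMk isOpen_univ ih (msmoothOn_proj i univ)) isOpen_univ isOpen_univ
      (mapsTo_univ _ _)

variable {G} in
theorem msmoothOn_bgMap {m n : SimplexCategory} (φ : m ⟶ n) (U : Set (Fin n.len → G)) :
    MSmoothOn (Fin n.len → E) (Fin m.len → E)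
      (bgMap φ : (Fin n.len → G) → Fin m.len → G) U := by
  refine MSmoothOn.mono (MSmoothOn.pi isOpen_univ fun k => ?_) (subset_univ U)
  have h1 := (FrechetLieGroup.smooth_inv (E := E) (G := G)).comp
    (msmoothOn_partialProd E (φ.toOrderHom k.castSucc) univ) isOpen_univ isOpen_univ
      (mapsTo_univ _ _)
  exact (FrechetLieGroup.smooth_mul (E := E) (G := G)).comp
    (MSmoothOn.prodMk isOpen_univ h1 (msmoothOn_partialProd E (φ.toOrderHom k.succ) univ))
    isOpen_univ isOpen_univ (mapsTo_univ _ _)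

variable {G} in
/-- The group `C^∞(U, A)` of smooth `A`-valued functions on an open subset `U` of `G^n`. -/
def smoothSections {n : ℕ} (U : Opens (Fin n → G)) : AddSubgroup (U → A) where
  carrier := {s | ∃ f : (Fin n → G) → A, MSmoothOn (Fin n → E) EA f U ∧ ∀ x : U, f x = s x}
  zero_mem' := ⟨fun _ => 0, msmoothOn_const 0 _, fun _ => rfl⟩
  add_mem' := by
    rintro s t ⟨f, hf, hfs⟩ ⟨g, hg, hgt⟩
    refine ⟨fun x => f x + g x, ?_, fun x => by simp [hfs, hgt]⟩
    exact (FrechetAddLieGroup.smooth_add (E := EA) (A := A)).comp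
      (MSmoothOn.prodMk U.isOpen hf hg) U.isOpen isOpen_univ (mapsTo_univ _ _)
  neg_mem' := by
    rintro s ⟨f, hf, hfs⟩
    refine ⟨fun x => -f x, ?_, fun x => by simp [hfs]⟩
    exact (FrechetAddLieGroup.smooth_neg (E := EA) (A := A)).comp hf U.isOpen isOpen_univ
      (mapsTo_univ _ _)

variable {G} in
/-- The transition morphisms of the simplicial sheaf `A`: for `φ : [m] ⟶ [n]`, a section `s` is sent
to `g ↦ (g_0 ⋯ g_{φ(0)-1}) • s (bgMap φ g)`. For a trivial action (and for the face maps `d_j`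
with `j > 0`) this is the pull-back of functions; for `d_0` it is
`g ↦ g_0 • s (g_1, …, g_{n-1})`. -/
def pullSection {X Y : BGOpen G} (f : Y ⟶ X) :
    smoothSections E EA A X.carrier →+ smoothSections E EA A Y.carrier where
  toFun s := ⟨fun y => Fin.partialProd y.1 (f.map.toOrderHom 0) •
      s.1 ⟨bgMap f.map y.1, f.mapsTo y.1 y.2⟩, by
    obtain ⟨F, hF, hFs⟩ := s.2
    refine ⟨fun y => Fin.partialProd y (f.map.toOrderHom 0) • F (bgMap f.map y), ?_,
      fun x => congrArg (Fin.partialProd x.1 (f.map.toOrderHom 0) • ·)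
        (hFs ⟨_, f.mapsTo _ x.2⟩)⟩
    exact (SmoothAction.smooth_smul (E := E) (EA := EA) (G := G) (A := A)).comp
      (MSmoothOn.prodMk Y.carrier.isOpen (msmoothOn_partialProd E _ _)
        (hF.comp (msmoothOn_bgMap E f.map _) Y.carrier.isOpen X.carrier.isOpen f.mapsTo))
      Y.carrier.isOpen isOpen_univ (mapsTo_univ _ _)⟩
  map_zero' := by ext; simp
  map_add' s t := by ext; simp

/-- The presheaf underlying the simplicial sheaf of smooth `A`-valued functions on `BG`. -/
def coeffPresheaf : (BGOpen G)ᵒᵖ ⥤ AddCommGrpCat.{u} where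
  obj X := AddCommGrpCat.of (smoothSections E EA A X.unop.carrier)
  map f := AddCommGrpCat.ofHom (pullSection E EA A f.unop)
  map_id X := by
    refine AddCommGrpCat.hom_ext (AddMonoidHom.ext fun s => Subtype.ext (funext fun x => ?_))
    change Fin.partialProd x.1 0 • s.1 ⟨bgMap (𝟙 _) x.1, _⟩ = s.1 x
    simp only [Fin.partialProd_zero, one_smul, bgMap_id]
  map_comp {X Y Z} f g := by
    refine AddCommGrpCat.hom_ext (AddMonoidHom.ext fun s => Subtype.ext (funext fun x => ?_))
    change Fin.partialProd x.1 ((f.unop.map ≫ g.unop.map).toOrderHom 0) •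
        s.1 ⟨bgMap (f.unop.map ≫ g.unop.map) x.1, _⟩ =
      Fin.partialProd x.1 (g.unop.map.toOrderHom 0) •
        (Fin.partialProd (bgMap g.unop.map x.1) (f.unop.map.toOrderHom 0) •
          s.1 ⟨bgMap f.unop.map (bgMap g.unop.map x.1), _⟩)
    simp only [partialProd_bgMap, smul_smul, mul_inv_cancel_left, bgMap_comp]
    rfl

theorem coeffPresheaf_isSheaf : Presheaf.IsSheaf (bgTopology G) (coeffPresheaf E EA G A) := by
  rw [Presheaf.isSheaf_iff_isSheaf_forget _ _ (forget AddCommGrpCat.{u}),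
    isSheaf_iff_isSheaf_of_type]
  intro X S hS x hx
  let y : ∀ ⦃Y : BGOpen G⦄ (f : Y ⟶ X), S f → smoothSections E EA A Y.carrier :=
    fun Y f hf => x f hf
  have hy : ∀ ⦃Y₁ Y₂ Z : BGOpen G⦄ (g₁ : Z ⟶ Y₁) (g₂ : Z ⟶ Y₂) ⦃f₁ : Y₁ ⟶ X⦄ ⦃f₂ : Y₂ ⟶ X⦄
      (h₁ : S f₁) (h₂ : S f₂), g₁ ≫ f₁ = g₂ ≫ f₂ →
      pullSection E EA A g₁ (y f₁ h₁) = pullSection E EA A g₂ (y f₂ h₂) := hx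
  have key : ∀ ⦃Y : BGOpen G⦄ (f : Y ⟶ X) (hf : S f) (V : Opens (Fin X.dim.len → G))
      (hV : V ≤ X.carrier) (hSV : S (BGOpen.incl hV : (⟨X.dim, V⟩ : BGOpen G) ⟶ X))
      (p : Fin Y.dim.len → G) (hp : p ∈ Y.carrier) (hpV : bgMap f.map p ∈ V),
      Fin.partialProd p (f.map.toOrderHom 0) • (y _ hSV).1 ⟨bgMap f.map p, hpV⟩ =
        (y f hf).1 ⟨p, hp⟩ := by
    intro Y f hf V hV hSV p hp hpV
    let W : Opens (Fin Y.dim.len → G) := Y.carrier ⊓ V.comap ⟨_, continuous_bgMap f.map⟩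
    let g₁ : (⟨Y.dim, W⟩ : BGOpen G) ⟶ ⟨X.dim, V⟩ :=
      (⟨f.map, fun g hg => hg.2⟩ : BGOpen.Hom ⟨Y.dim, W⟩ ⟨X.dim, V⟩)
    let g₂ : (⟨Y.dim, W⟩ : BGOpen G) ⟶ Y := BGOpen.incl inf_le_left
    have h := hy g₁ g₂ hSV hf
      (BGOpen.Hom.ext ((Category.id_comp f.map).trans (Category.comp_id f.map).symm))
    have h2 := congrFun (congrArg Subtype.val h) ⟨p, hp, hpV⟩
    refine h2.trans ?_
    change Fin.partialProd p 0 • (y f hf).1 ⟨bgMap (𝟙 _) p, _⟩ = _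
    simp only [Fin.partialProd_zero, one_smul, bgMap_id]
  have hincl : ∀ (V : Opens (Fin X.dim.len → G)) (hV : V ≤ X.carrier)
      (s : smoothSections E EA A X.carrier) (p : Fin X.dim.len → G) (hp : p ∈ V),
      (pullSection E EA A (BGOpen.incl hV : (⟨X.dim, V⟩ : BGOpen G) ⟶ X) s).1 ⟨p, hp⟩ =
        s.1 ⟨p, hV hp⟩ := by
    intro V hV s p hp
    change Fin.partialProd p 0 • s.1 ⟨bgMap (𝟙 _) p, _⟩ = _
    simp only [Fin.partialProd_zero, one_smul, bgMap_id]
  choose V hV hpV hSV using hS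
  let t : X.carrier → A := fun p => (y _ (hSV p.1 p.2)).1 ⟨p.1, hpV p.1 p.2⟩
  have ht : ∀ (p : Fin X.dim.len → G) (hp : p ∈ X.carrier) (q : Fin X.dim.len → G)
      (hq : q ∈ X.carrier) (hqV : q ∈ V p hp), t ⟨q, hq⟩ = (y _ (hSV p hp)).1 ⟨q, hqV⟩ := by
    intro p hp q hq hqV
    have := key (BGOpen.incl (hV p hp)) (hSV p hp) _ (hV q hq) (hSV q hq) q hqV
      (by change bgMap (𝟙 _) q ∈ _; rw [bgMap_id]; exact hpV q hq)
    rw [← this]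
    change _ = Fin.partialProd q 0 • (y _ (hSV q hq)).1 ⟨bgMap (𝟙 _) q, _⟩
    simp only [Fin.partialProd_zero, one_smul, bgMap_id, t]
  have hts : t ∈ smoothSections E EA A X.carrier := by
    classical
    refine ⟨fun p => if hp : p ∈ X.carrier then t ⟨p, hp⟩ else 0, ?_, fun p => by simp⟩
    refine MSmoothOn.of_local fun p hp => ⟨V p hp, (V p hp).isOpen, hpV p hp, ?_⟩
    obtain ⟨F, hF, hFs⟩ := (y _ (hSV p hp)).2
    have hsub : (X.carrier : Set (Fin X.dim.len → G)) ∩ (V p hp : Set (Fin X.dim.len → G)) ⊆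
        (V p hp : Set (Fin X.dim.len → G)) := inter_subset_right
    refine (hF.mono hsub).congr (X.carrier.isOpen.inter (V p hp).isOpen) ?_
    rintro q ⟨hq, hqV⟩
    have hq' : q ∈ X.carrier := hq
    simp only [dif_pos hq']
    rw [ht p hp q hq hqV]
    exact hFs ⟨q, hqV⟩
  refine ⟨(⟨t, hts⟩ : smoothSections E EA A X.carrier), ?_, ?_⟩
  · intro Y f hf
    refine Subtype.ext (funext fun p => ?_)
    exact key f hf _ (hV _ (f.mapsTo _ p.2)) (hSV _ (f.mapsTo _ p.2)) p.1 p.2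
      (hpV _ (f.mapsTo _ p.2))
  · intro s hs
    refine Subtype.ext (funext fun p => ?_)
    have h := congrFun (congrArg Subtype.val (hs _ (hSV p.1 p.2))) ⟨p.1, hpV p.1 p.2⟩
    exact (hincl _ (hV p.1 p.2) s p.1 (hpV p.1 p.2)).symm.trans h

/-- The simplicial sheaf of smooth `A`-valued functions on `BG`. -/
def coeffSheaf : Sheaf (bgTopology G) AddCommGrpCat.{u} :=
  ⟨coeffPresheaf E EA G A, coeffPresheaf_isSheaf E EA G A⟩

/-- The differentiable cohomology group `H^n_diff(G, A)`: the hypercohomology of `BG` with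
coefficients in the simplicial sheaf of smooth `A`-valued functions, i.e. the cohomology of the
category of simplicial sheaves on `BG`, the `Ext` group `Ext^n(ℤ, A)`. -/
abbrev HDiff (n : ℕ) : Type u := (coeffSheaf E EA G A).H n

end Coefficients

section Cech

variable {G : Type u} [Group G] [TopologicalSpace G] [IsTopologicalGroup G]

/-- A simplicial family of open sets of the `G^n`: a simplicial set `J` and, for each `j ∈ J_n`, an
open subset `U_j ⊆ G^n`, such that every simplicial operator maps `U_j` into `U_{φ^* j}`; for the
face and degeneracy maps this says `d_k U_j ⊆ U_{d_k j}` and `s_k U_j ⊆ U_{s_k j}`. -/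
structure SimplicialOpens (G : Type u) [Group G] [TopologicalSpace G] where
  index : SSet.{w}
  opens : ∀ n : SimplexCategory, index.obj (op n) → Opens (Fin n.len → G)
  mapsTo : ∀ {m n : SimplexCategory} (φ : m ⟶ n) (j : index.obj (op n)),
    ∀ g ∈ opens n j, bgMap φ g ∈ opens m (index.map φ.op j)

namespace SimplicialOpens

variable (𝒰 : SimplicialOpens.{u, w} G)

/-- The family is a simplicial open covering: its members cover every `G^n`. -/
def IsCovering : Prop := ∀ (n : SimplexCategory) (g : Fin n.len → G), ∃ j, g ∈ 𝒰.opens n j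

/-- The intersection `U_{j_0} ∩ ⋯ ∩ U_{j_r}`, as an object of the site of `BG`. -/
def cell {n : SimplexCategory} {r : ℕ} (j : Fin (r + 1) → 𝒰.index.obj (op n)) : BGOpen G :=
  ⟨n, ⟨⋂ k, (𝒰.opens n (j k) : Set (Fin n.len → G)),
    isOpen_iInter_of_finite fun k => (𝒰.opens n (j k)).isOpen⟩⟩

/-- The morphism induced by `d_k` on intersections. -/
def faceHom {p r : ℕ} (j : Fin (r + 1) → 𝒰.index.obj (op (SimplexCategory.mk (p + 1))))
    (k : Fin (p + 2)) : 𝒰.cell j ⟶ 𝒰.cell fun l => 𝒰.index.δ k (j l) :=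
  (⟨SimplexCategory.δ k, fun g hg => mem_iInter.2 fun l =>
    𝒰.mapsTo (SimplexCategory.δ k) (j l) g (mem_iInter.1 hg l)⟩ : BGOpen.Hom _ _)

/-- The inclusion of `U_{j_0 … j_r}` into the intersection where `j_k` is omitted. -/
def omitHom {n : SimplexCategory} {r : ℕ} (j : Fin (r + 2) → 𝒰.index.obj (op n))
    (k : Fin (r + 2)) : 𝒰.cell j ⟶ 𝒰.cell fun l => j (k.succAbove l) :=
  BGOpen.incl fun _ hg => mem_iInter.2 fun l => mem_iInter.1 hg (k.succAbove l)

/-- The index `i ∈ J_n` has `1 ∈ U_i` and all its faces are equal: `d_0 i = d_1 i = ⋯ = d_n i`. -/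
def Distinguished : (n : ℕ) → 𝒰.index.obj (op (SimplexCategory.mk n)) → Prop
  | 0, i => 1 ∈ 𝒰.opens _ i
  | n + 1, i => 1 ∈ 𝒰.opens _ i ∧ ∀ k l : Fin (n + 2), 𝒰.index.δ k i = 𝒰.index.δ l i

variable {𝒰} in
theorem Distinguished.one_mem {n : ℕ} {i : 𝒰.index.obj (op (SimplexCategory.mk n))}
    (h : 𝒰.Distinguished n i) : 1 ∈ 𝒰.opens _ i := by
  cases n with
  | zero => exact h
  | succ n => exact h.1

/-- Families of Čech cochains: in bidegree `(p, r)`, a section of `F` over `U_{j_0 … j_r} ⊆ G^p`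
for all `j_0, …, j_r ∈ J_p`. -/
abbrev Cochain (F : Sheaf (bgTopology G) AddCommGrpCat.{u}) : Type (max u w) :=
  ∀ (p r : ℕ) (j : Fin (r + 1) → 𝒰.index.obj (op (SimplexCategory.mk p))),
    F.obj.obj (op (𝒰.cell j))

variable {𝒰} {F F' : Sheaf (bgTopology G) AddCommGrpCat.{u}}

/-- The differential of bidegree `(1, 0)`: `∑ₖ (-1)^k d_k^*`. -/
def simplicialD (c : 𝒰.Cochain F) : 𝒰.Cochain F
  | 0, _ => 0
  | p + 1, r => fun j => ∑ k : Fin (p + 2), (-1 : ℤ) ^ (k : ℕ) •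
      F.obj.map (𝒰.faceHom j k).op (c p r fun l => 𝒰.index.δ k (j l))

/-- The Čech differential, of bidegree `(0, 1)`. -/
def cechD (c : 𝒰.Cochain F) : 𝒰.Cochain F
  | _, 0 => 0
  | p, r + 1 => fun j => ∑ k : Fin (r + 2), (-1 : ℤ) ^ (k : ℕ) •
      F.obj.map (𝒰.omitHom j k).op (c p r fun l => j (k.succAbove l))

/-- The differential of the total complex of the Čech double complex. -/
def totalD (c : 𝒰.Cochain F) : 𝒰.Cochain F :=
  fun p r => simplicialD c p r + (-1 : ℤ) ^ p • cechD c p r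

/-- `g = (g^0, …, g^n)` is a cocycle of total degree `n` in the Čech double complex; `g^p` is the
component `g p (n - p)` and the components of other bidegrees vanish. -/
def IsCocycle (n : ℕ) (g : 𝒰.Cochain F) : Prop :=
  (∀ p r, p + r ≠ n → g p r = 0) ∧ totalD g = 0

/-- The map on Čech cochains induced by a morphism of simplicial sheaves. -/
def mapCochain (f : F ⟶ F') (c : 𝒰.Cochain F) : 𝒰.Cochain F' :=
  fun p r j => f.hom.app (op (𝒰.cell j)) (c p r j)

/-- The differential of the total complex of the triple complex of Čech cochains with
coefficients in a complex of simplicial sheaves. -/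
def resolutionD {K : CochainComplex (Sheaf (bgTopology G) AddCommGrpCat.{u}) ℕ}
    (b : ∀ q, 𝒰.Cochain (K.X q)) : ∀ q, 𝒰.Cochain (K.X q)
  | 0 => totalD (b 0)
  | q + 1 => fun p r => totalD (b (q + 1)) p r +
      (-1 : ℤ) ^ (p + r) • mapCochain (K.d q (q + 1)) (b q) p r

/-- The image, in the triple complex, of a Čech cochain with coefficients in `F` under a
coaugmentation `F ⟶ K^0`. -/
def augment {K : CochainComplex (Sheaf (bgTopology G) AddCommGrpCat.{u}) ℕ} (f : F ⟶ K.X 0)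
    (g : 𝒰.Cochain F) : ∀ q, 𝒰.Cochain (K.X q)
  | 0 => mapCochain f g
  | _ + 1 => 0

/-- The section `1` of the constant sheaf `ℤ`. -/
noncomputable def oneSection (X : BGOpen G) :
    ((constantSheaf (bgTopology G) AddCommGrpCat.{u}).obj
      (AddCommGrpCat.of (ULift.{u} ℤ))).obj.obj (op X) :=
  (toSheafify (bgTopology G) ((Functor.const _).obj (AddCommGrpCat.of (ULift.{u} ℤ)))).app (op X)
    (ULift.up 1 : ULift.{u} ℤ)

/-- The image, in the triple complex, of a global section of `K^n` over `BG` (a morphism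
`ℤ ⟶ K^n`): restrict its component on `G^0` to the members of the covering of `G^0`. -/
noncomputable def ofSection {K : CochainComplex (Sheaf (bgTopology G) AddCommGrpCat.{u}) ℕ} {n : ℕ}
    (s : (constantSheaf (bgTopology G) AddCommGrpCat.{u}).obj
      (AddCommGrpCat.of (ULift.{u} ℤ)) ⟶ K.X n) : ∀ q, 𝒰.Cochain (K.X q)
  | q, 0, 0 => fun j => (Pi.single (M := fun q =>
      (constantSheaf (bgTopology G) AddCommGrpCat.{u}).obj (AddCommGrpCat.of (ULift.{u} ℤ)) ⟶ K.X q)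
        n s q).hom.app (op (𝒰.cell j)) (oneSection (𝒰.cell j))
  | _, _, _ => 0

/-- The Čech cocycle `g` of total degree `n` represents the class `x ∈ H^n(BG, F)`, under the
standard comparison of Čech and sheaf cohomology: for some injective resolution `F → I`, the class
`x` is given by a global section `s` of `I^n` with `ds = 0`, and the images of `g` and of `s` in the
triple complex of Čech cochains with coefficients in `I` are cohomologous. -/
def Represents (n : ℕ) (g : 𝒰.Cochain F) (x : F.H n) : Prop :=
  IsCocycle n g ∧ ∃ (I : InjectiveResolution F)
    (s : (constantSheaf (bgTopology G) AddCommGrpCat.{u}).obj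
      (AddCommGrpCat.of (ULift.{u} ℤ)) ⟶ I.cocomplex.X n)
    (hs : s ≫ I.cocomplex.d n (n + 1) = 0),
    I.extMk s (n + 1) rfl hs = x ∧
    ∃ b : ∀ q, 𝒰.Cochain (I.cocomplex.X q), (∀ q p r, q + p + r + 1 ≠ n → b q p r = 0) ∧
      resolutionD b = augment (I.ι.f 0) g - ofSection s

end SimplicialOpens

end Cech

section Local

variable (E : Type*) [AddCommGroup E] [Module ℝ E] [TopologicalSpace E] [FrechetSpace E]
  (EA : Type*) [AddCommGroup EA] [Module ℝ EA] [TopologicalSpace EA] [FrechetSpace EA]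
  (G : Type u) [Group G] [TopologicalSpace G] [IsTopologicalGroup G] [ChartedSpace E G]
  [FrechetLieGroup E G]
  (A : Type u) [AddCommGroup A] [TopologicalSpace A] [IsTopologicalAddGroup A]
  [ChartedSpace EA A] [FrechetAddLieGroup EA A] [DistribMulAction G A] [SmoothAction E EA G A]

/-- The group `C^∞_loc(G^n, A)` of germs at `(1, …, 1)` of smooth functions `G^n → A`. -/
def smoothGerms (n : ℕ) : AddSubgroup (Germ (𝓝 (1 : Fin n → G)) A) where
  carrier := {γ | ∃ (f : (Fin n → G) → A) (U : Set (Fin n → G)), IsOpen U ∧ 1 ∈ U ∧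
    MSmoothOn (Fin n → E) EA f U ∧ γ = (f : Germ (𝓝 (1 : Fin n → G)) A)}
  zero_mem' := ⟨fun _ => 0, univ, isOpen_univ, mem_univ _, msmoothOn_const 0 _, rfl⟩
  add_mem' := by
    rintro _ _ ⟨f, U, hU, h1, hf, rfl⟩ ⟨g, V, hV, h2, hg, rfl⟩
    refine ⟨fun x => f x + g x, U ∩ V, hU.inter hV, ⟨h1, h2⟩, ?_, rfl⟩
    exact (FrechetAddLieGroup.smooth_add (E := EA) (A := A)).comp
      (MSmoothOn.prodMk (hU.inter hV) (hf.mono inter_subset_left) (hg.mono inter_subset_right))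
      (hU.inter hV) isOpen_univ (mapsTo_univ _ _)
  neg_mem' := by
    rintro _ ⟨f, U, hU, h1, hf, rfl⟩
    refine ⟨fun x => -f x, U, hU, h1, ?_, rfl⟩
    exact (FrechetAddLieGroup.smooth_neg (E := EA) (A := A)).comp hf hU isOpen_univ
      (mapsTo_univ _ _)

/-- The transition morphisms on germs at `1`: the germ of `f` is sent to the germ of
`g ↦ (g_0 ⋯ g_{φ(0)-1}) • f (bgMap φ g)`. -/
def germPull {m n : SimplexCategory} (φ : m ⟶ n) :
    Germ (𝓝 (1 : Fin m.len → G)) A →+ Germ (𝓝 (1 : Fin n.len → G)) A where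
  toFun γ := Germ.map₂ (fun (g : G) (a : A) => g • a)
    ((fun g => Fin.partialProd g (φ.toOrderHom 0) : (Fin n.len → G) → G) :
      Germ (𝓝 (1 : Fin n.len → G)) G)
    (γ.compTendsto (bgMap φ) ((continuous_bgMap φ).tendsto' 1 1 (bgMap_one φ)))
  map_zero' := congrArg Germ.ofFun (funext fun _ => smul_zero _)
  map_add' γ γ' := by
    induction γ using Germ.inductionOn with | _ f
    induction γ' using Germ.inductionOn with | _ f'
    exact congrArg Germ.ofFun (funext fun _ => smul_add _ _ _)

theorem germPull_mem {m n : SimplexCategory} (φ : m ⟶ n) {γ : Germ (𝓝 (1 : Fin m.len → G)) A}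
    (hγ : γ ∈ smoothGerms E EA G A m.len) : germPull G A φ γ ∈ smoothGerms E EA G A n.len := by
  obtain ⟨f, U, hU, h1, hf, rfl⟩ := hγ
  refine ⟨fun y => Fin.partialProd y (φ.toOrderHom 0) • f (bgMap φ y), bgMap φ ⁻¹' U,
    hU.preimage (continuous_bgMap φ), by rwa [mem_preimage, bgMap_one], ?_, rfl⟩
  exact (SmoothAction.smooth_smul (E := E) (EA := EA) (G := G) (A := A)).comp
    (MSmoothOn.prodMk (hU.preimage (continuous_bgMap φ)) (msmoothOn_partialProd E _ _)
      (hf.comp (msmoothOn_bgMap E φ _) (hU.preimage (continuous_bgMap φ)) hU (mapsTo_preimage _ _)))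
    (hU.preimage (continuous_bgMap φ)) isOpen_univ (mapsTo_univ _ _)

/-- The differential `d_0^* - d_1^* + ⋯ + (-1)^(n+1) d_{n+1}^*` of the complex of germs. -/
def localD (n : ℕ) : smoothGerms E EA G A n →+ smoothGerms E EA G A (n + 1) :=
  ((∑ k : Fin (n + 2), (-1 : ℤ) ^ (k : ℕ) •
    (germPull G A (SimplexCategory.δ k) : Germ (𝓝 (1 : Fin n → G)) A →+
      Germ (𝓝 (1 : Fin (n + 1) → G)) A)).comp (smoothGerms E EA G A n).subtype).codRestrict _
    fun γ => by
      simp only [AddMonoidHom.comp_apply, AddMonoidHom.finsetSum_apply, AddMonoidHom.smul_apply]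
      exact AddSubgroup.sum_mem _ fun k _ => AddSubgroup.zsmul_mem _
        (germPull_mem E EA G A (SimplexCategory.δ k) γ.2) _

/-- Local smooth `n`-cocycles. -/
def localCocycles (n : ℕ) : AddSubgroup (smoothGerms E EA G A n) := (localD E EA G A n).ker

/-- Local smooth `n`-coboundaries. -/
def localCoboundaries : (n : ℕ) → AddSubgroup (smoothGerms E EA G A n)
  | 0 => ⊥
  | n + 1 => (localD E EA G A n).range

/-- The local differentiable cohomology group `H^n_loc(G, A)`. -/
abbrev HLoc (n : ℕ) : Type u :=
  localCocycles E EA G A n ⧸ (localCoboundaries E EA G A n).addSubgroupOf (localCocycles E EA G A n)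

variable {G} in
open Classical in
/-- The germ at `1` of a smooth function on an open neighbourhood of `1` in `G^n`. -/
noncomputable def sectionGerm {n : ℕ} (U : Opens (Fin n → G)) (h : 1 ∈ U)
    (s : smoothSections E EA A U) : smoothGerms E EA G A n :=
  ⟨((fun g => if hg : g ∈ U then s.1 ⟨g, hg⟩ else 0 : (Fin n → G) → A) :
    Germ (𝓝 (1 : Fin n → G)) A), by
    obtain ⟨f, hf, hfs⟩ := s.2
    refine ⟨f, U, U.isOpen, h, hf, Germ.coe_eq.2 ?_⟩
    filter_upwards [U.isOpen.mem_nhds h] with g hg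
    have hg' : g ∈ U := hg
    rw [dif_pos hg', ← hfs]⟩

variable {G} in
/-- The germ at `1` of the component `g^n_U` on `U = U_i ⊆ G^n` of the top term `g^n` of a Čech
cochain `(g^0, …, g^n)` with coefficients in the sheaf of smooth `A`-valued functions. -/
noncomputable def topGerm {n : ℕ} {𝒰 : SimplicialOpens.{u, w} G}
    (g : 𝒰.Cochain (coeffSheaf E EA G A)) (i : 𝒰.index.obj (op (SimplexCategory.mk n)))
    (hi : 𝒰.Distinguished n i) : smoothGerms E EA G A n :=
  sectionGerm E EA A (𝒰.cell fun _ : Fin 1 => i).carrier (mem_iInter.2 fun _ => hi.one_mem)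
    (g n 0 fun _ => i)

end Local

end DiffCoh

/-! Only a neighbourhood of the unit matters, and there the covering can be forgotten. All structure
maps of BG fix 1, and there are finitely many between two given degrees, so every neighbourhood of 1
in some G^p contains the degree p member of a simplicial neighbourhood: one open set per degree,
stable under all operators (`IdentityNhd`, `exists_opens_le`). Over it, the sections of an injective
resolution I of A form a double complex with no Čech direction, whose vertical differential d is
exact up to shrinking. Write δ for the simplicial differential.

Let a closed global section s of I^n give a class. For n > 0, lifting along d and applying δ
alternately joins s, after finitely many shrinkings, to a section a of A near 1 in G^n with δa = 0;
for n = 0, s itself comes from such an a. This zigzag is a ladder (`exists_isLadder`). If s = dt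
with t global, correcting the ladder step by step gives a = δc near 1 (`IsLadder.exists_secD_eq`).
Ladders can be subtracted on intersections of neighbourhoods, so sending the class of s to the germ
of a is a well-defined homomorphism to local cohomology.

In a simplicial family, the totally degenerate indices over a vertex v with 1 ∈ U_v are permuted by
the operators without leaving the family over v, and their open sets form a simplicial
neighbourhood. Restricted to these single indices, the Čech differential disappears, and the
trivialization in `Represents` becomes a ladder ending in the top component of the cocycle
(`isLadder_of_resolutionD`). Two distinguished indices are compared by the cocycle identity on the
intersection of their open sets: since the faces of each index coincide, the simplicial term is the
coboundary of a single germ (`IsCocycle.topGerm_sub_mem`). Conversely, a ladder is a representing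
cocycle on the family with one index per degree (`IsLadder.represents`). So every class is
represented, which gives uniqueness. -/

namespace CategoryTheory

/-! ### Lifting sections along exact sequences of sheaves -/

open Abelian

variable {C : Type*} [Category* C] {J : GrothendieckTopology C}
  [HasSheafify J AddCommGrpCat.{u}]

/-- Sections of sheaves form a left exact functor. -/
theorem Sheaf.exists_section_of_exact_of_mono
    {S : ShortComplex (Sheaf J AddCommGrpCat.{u})} (hS : S.Exact) [Mono S.f] (X : C)
    (z : S.X₂.obj.obj (op X)) (hz : S.g.hom.app (op X) z = 0) :
    ∃ y : S.X₁.obj.obj (op X), S.f.hom.app (op X) y = z := by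
  let Γ : Sheaf J AddCommGrpCat.{u} ⥤ AddCommGrpCat.{u} :=
    sheafToPresheaf J _ ⋙ (evaluation _ _).obj (op X)
  have : Γ.PreservesZeroMorphisms := ⟨fun _ _ => rfl⟩
  have h := hS.map_of_mono_of_preservesKernel Γ inferInstance inferInstance
  exact (ShortComplex.ab_exact_iff _).1 h z hz

/-- Sections killed by the second morphism of an exact sequence of sheaves lift locally. -/
theorem Sheaf.imageSieve_mem_of_exact
    [J.HasSheafCompose (forget AddCommGrpCat.{u})]
    [J.WEqualsLocallyBijective AddCommGrpCat.{u}] [Balanced (Sheaf J AddCommGrpCat.{u})]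
    {S : ShortComplex (Sheaf J AddCommGrpCat.{u})} (hS : S.Exact) {X : C}
    (z : S.X₂.obj.obj (op X)) (hz : S.g.hom.app (op X) z = 0) :
    Presheaf.imageSieve S.f.hom z ∈ J X := by
  -- Exactness makes the map to the cycles an epimorphism, that is, locally surjective. By left
  -- exactness z is a section of the cycles, so it lifts locally.
  have := S.exact_iff_epi_toCycles.1 hS
  have hs : Sheaf.IsLocallySurjective S.toCycles :=
    (Sheaf.isLocallySurjective_iff_epi' _ _).2 inferInstance
  have hk : (ShortComplex.mk S.iCycles S.g (by simp)).Exact :=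
    ShortComplex.exact_of_f_is_kernel _ S.cyclesIsKernel
  obtain ⟨y, rfl⟩ := Sheaf.exists_section_of_exact_of_mono hk (X := X) z hz
  refine J.superset_covering ?_ (hs.imageSieve_mem y)
  rintro Y f ⟨t, ht⟩
  refine ⟨t, ?_⟩
  have h1 : S.f.hom.app (op Y) t = S.iCycles.hom.app (op Y) (S.toCycles.hom.app (op Y) t) := by
    rw [← ConcreteCategory.comp_apply]
    congr 2
    rw [← NatTrans.comp_app]
    exact congrArg (fun f => f.hom.app (op Y)) S.toCycles_i.symm
  refine h1.trans ?_
  rw [ht]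
  exact NatTrans.naturality_apply S.iCycles.hom f.op y

/-- A class in degree zero vanishes only if the section representing it does. -/
theorem InjectiveResolution.eq_zero_of_extMk_eq_zero {C : Type*} [Category* C] [Abelian C]
    [HasExt.{w} C] {X Y : C} (R : InjectiveResolution Y) (f : X ⟶ R.cocomplex.X 0)
    (hf : f ≫ R.cocomplex.d 0 1 = 0) (h : R.extMk f 1 rfl hf = 0) : f = 0 := by
  rw [← R.extEquivCohomologyClass.apply_eq_iff_eq, R.extEquivCohomologyClass_extMk,
    R.extEquivCohomologyClass_zero, CochainComplex.HomComplex.CohomologyClass.mk_eq_zero_iff,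
    CochainComplex.HomComplex.Cocycle.fromSingleMk_mem_coboundaries_iff _ _ _ _ _ (-1) (by lia)]
    at h
  obtain ⟨g, hg⟩ := h
  -- A coboundary in degree 0 factors through degree -1, where the resolution is zero.
  have hz := CochainComplex.isZero_of_isStrictlyGE R.cochainComplex 0 (-1) (by lia)
  rw [hz.eq_of_tgt g 0, Limits.zero_comp] at hg
  rw [← cancel_mono (R.cochainComplexXIso 0 0 rfl).inv, Limits.zero_comp]
  exact hg.symm

end CategoryTheory

namespace DiffCoh

/-! ### Simplicial neighbourhoods of the unit -/

section

variable {G : Type u} [Group G] [TopologicalSpace G] [IsTopologicalGroup G]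

/-- A covering sieve for `bgTopology` contains, around each point, the inclusion of an honest open
subset. The local lift therefore exists on a neighbourhood in the same power of G. -/
theorem exists_local_lift {K : CochainComplex (Sheaf (bgTopology G) AddCommGrpCat.{u}) ℕ} {q : ℕ}
    (hK : (ShortComplex.mk _ _ (K.d_comp_d q (q + 1) (q + 2))).Exact) {X : BGOpen G}
    (z : (K.X (q + 1)).obj.obj (op X)) (hz : (K.d (q + 1) (q + 2)).hom.app (op X) z = 0)
    {x : Fin X.dim.len → G} (hx : x ∈ X.carrier) :
    ∃ (V : Opens (Fin X.dim.len → G)) (h : V ≤ X.carrier), x ∈ V ∧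
      ∃ y : (K.X q).obj.obj (op ⟨X.dim, V⟩),
        (K.d q (q + 1)).hom.app _ y = (K.X (q + 1)).obj.map (BGOpen.incl h).op z := 
  Sheaf.imageSieve_mem_of_exact hK z hz x hx

end

section

variable {G : Type u} [Group G] [TopologicalSpace G] [IsTopologicalGroup G]

/-- A simplicial neighbourhood of the unit: open neighbourhoods of `1` in all `G^n` which are
preserved by all simplicial operators. -/
structure IdentityNhd (G : Type u) [Group G] [TopologicalSpace G] where
  opens : ∀ n : SimplexCategory, Opens (Fin n.len → G)
  one_mem : ∀ n, 1 ∈ opens n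
  mapsTo : ∀ {m n : SimplexCategory} (φ : m ⟶ n), ∀ g ∈ opens n, bgMap φ g ∈ opens m

namespace IdentityNhd

variable (U V : IdentityNhd G)

instance : PartialOrder (IdentityNhd G) := PartialOrder.lift opens fun U V h => by
  cases U; cases V; cases h; rfl

instance : Min (IdentityNhd G) :=
  ⟨fun U V => ⟨fun n => U.opens n ⊓ V.opens n, fun n => ⟨U.one_mem n, V.one_mem n⟩,
    fun φ g hg => ⟨U.mapsTo φ g hg.1, V.mapsTo φ g hg.2⟩⟩⟩

theorem inf_le_left : U ⊓ V ≤ U := fun _ => (_root_.inf_le_left : _ ⊓ _ ≤ _)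

theorem inf_le_right : U ⊓ V ≤ V := fun _ => (_root_.inf_le_right : _ ⊓ _ ≤ _)

/-- In degree n, intersect the preimages of W under all operators `p ⟶ n`. There are finitely many,
so the result is open; all fix 1; composing with a further operator only permits more conditions
already imposed; and the identity of p gives the inclusion in W. -/
theorem exists_opens_le (p : SimplexCategory) (W : Opens (Fin p.len → G)) (hW : 1 ∈ W) :
    ∃ U : IdentityNhd G, U.opens p ≤ W := by
  refine ⟨⟨fun n => ⟨⋂ φ : p ⟶ n, bgMap φ ⁻¹' (W : Set (Fin p.len → G)), ?_⟩, fun n => ?_,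
    fun φ g hg => ?_⟩, fun g hg => ?_⟩
  · have : Finite (p ⟶ n) := Finite.of_injective (fun φ => (φ.toOrderHom : _ → _))
      fun φ ψ h => SimplexCategory.Hom.ext _ _ (OrderHom.ext _ _ h)
    exact isOpen_iInter_of_finite fun φ => W.isOpen.preimage (continuous_bgMap φ)
  · exact mem_iInter.2 fun φ => by rw [mem_preimage, bgMap_one]; exact hW
  · refine mem_iInter.2 fun ψ => ?_
    rw [mem_preimage, ← bgMap_comp]
    exact mem_iInter.1 hg (ψ ≫ φ)
  · have := mem_iInter.1 hg (𝟙 p)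
    rwa [mem_preimage, bgMap_id] at this

/-- The member of degree `n`, as an object of the site of `BG`. -/
def obj (n : ℕ) : BGOpen G := ⟨SimplexCategory.mk n, U.opens _⟩

/-- The face map `d_k`. -/
def face (n : ℕ) (k : Fin (n + 2)) : U.obj (n + 1) ⟶ U.obj n :=
  (⟨SimplexCategory.δ k, U.mapsTo _⟩ : BGOpen.Hom _ _)

variable {U V}

/-- The inclusion of a smaller simplicial neighbourhood. -/
def incl (h : U ≤ V) (n : ℕ) : U.obj n ⟶ V.obj n := BGOpen.incl (h _)

variable (U)

/-- The members form a simplicial object of the site. -/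
def simplicial : CategoryTheory.SimplicialObject (BGOpen G) where
  obj n := ⟨n.unop, U.opens n.unop⟩
  map φ := (⟨φ.unop, U.mapsTo φ.unop⟩ : BGOpen.Hom ⟨_, U.opens _⟩ ⟨_, U.opens _⟩)
  map_id _ := rfl
  map_comp _ _ := rfl

/-- The sections of a presheaf on a simplicial neighbourhood form a cosimplicial group. -/
def sections (P : (BGOpen G)ᵒᵖ ⥤ AddCommGrpCat.{u}) :
    CategoryTheory.CosimplicialObject AddCommGrpCat.{u} :=
  Functor.rightOp U.simplicial ⋙ P

/-- The differential `∑ₖ (-1)^k d_k^*` on the sections over a simplicial neighbourhood. -/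
def faceD (P : (BGOpen G)ᵒᵖ ⥤ AddCommGrpCat.{u}) (n : ℕ) :
    P.obj (op (U.obj n)) →+ P.obj (op (U.obj (n + 1))) :=
  ∑ k : Fin (n + 2), (-1 : ℤ) ^ (k : ℕ) • ConcreteCategory.hom (P.map (U.face n k).op)

theorem faceD_apply (P : (BGOpen G)ᵒᵖ ⥤ AddCommGrpCat.{u}) (n : ℕ) (x : P.obj (op (U.obj n))) :
    U.faceD P n x = ∑ k : Fin (n + 2), (-1 : ℤ) ^ (k : ℕ) • P.map (U.face n k).op x := by
  simp only [faceD, AddMonoidHom.finsetSum_apply, AddMonoidHom.smul_apply]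

/-- `faceD` is the differential of the alternating coface complex of the cosimplicial group
`sections`, whose square vanishes by the cosimplicial identities. -/
theorem faceD_faceD (P : (BGOpen G)ᵒᵖ ⥤ AddCommGrpCat.{u}) (n : ℕ) (x : P.obj (op (U.obj n))) :
    U.faceD P (n + 1) (U.faceD P n x) = 0 := by
  have key : ∀ n, (AlgebraicTopology.AlternatingCofaceMapComplex.objD (U.sections P) n).hom =
      U.faceD P n := fun n => by
    refine (map_sum AddCommGrpCat.homAddEquiv _ _).trans (Finset.sum_congr rfl fun k _ => ?_)
    rfl
  have h := AlgebraicTopology.AlternatingCofaceMapComplex.d_squared (U.sections P) n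
  have h2 := congrArg (fun f => f.hom x) h
  simp only [AddCommGrpCat.hom_comp, key] at h2
  exact h2

variable {U}

theorem faceD_incl (h : U ≤ V) (P : (BGOpen G)ᵒᵖ ⥤ AddCommGrpCat.{u}) (n : ℕ)
    (x : P.obj (op (V.obj n))) :
    U.faceD P n (P.map (incl h n).op x) = P.map (incl h (n + 1)).op (V.faceD P n x) := by
  simp only [faceD_apply, map_sum, map_zsmul, ← ConcreteCategory.comp_apply, ← P.map_comp, ← op_comp]
  refine Finset.sum_congr rfl fun k _ => ?_
  have : U.face n k ≫ incl h n = incl h (n + 1) ≫ V.face n k :=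
    BGOpen.Hom.ext ((Category.id_comp _).trans (Category.comp_id _).symm)
  rw [this]

theorem incl_incl {W : IdentityNhd G} (h : U ≤ V) (h' : V ≤ W) (P : (BGOpen G)ᵒᵖ ⥤ AddCommGrpCat.{u})
    (n : ℕ) (x : P.obj (op (W.obj n))) :
    P.map (incl h n).op (P.map (incl h' n).op x) = P.map (incl (h.trans h') n).op x := by
  rw [← ConcreteCategory.comp_apply, ← P.map_comp, ← op_comp]
  congr 4

theorem faceD_app {P Q : (BGOpen G)ᵒᵖ ⥤ AddCommGrpCat.{u}} (α : P ⟶ Q) (n : ℕ)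
    (x : P.obj (op (U.obj n))) :
    U.faceD Q n (α.app _ x) = α.app _ (U.faceD P n x) := by
  simp only [faceD_apply, map_sum, map_zsmul, NatTrans.naturality_apply]

/-- The lift near 1 lives in the single degree n; shrinking all degrees at once keeps the face maps
available for the next step of a zigzag. -/
theorem exists_lift {K : CochainComplex (Sheaf (bgTopology G) AddCommGrpCat.{u}) ℕ} {q : ℕ}
    (hK : (ShortComplex.mk _ _ (K.d_comp_d q (q + 1) (q + 2))).Exact) {n : ℕ}
    (z : (K.X (q + 1)).obj.obj (op (U.obj n)))
    (hz : (K.d (q + 1) (q + 2)).hom.app _ z = 0) :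
    ∃ (V : IdentityNhd G) (h : V ≤ U), ∃ y : (K.X q).obj.obj (op (V.obj n)),
        (K.d q (q + 1)).hom.app _ y = (K.X (q + 1)).obj.map (incl h n).op z := by
  obtain ⟨W, hW, h1, y, hy⟩ := exists_local_lift hK z hz (U.one_mem _)
  obtain ⟨V, hV⟩ := exists_opens_le (SimplexCategory.mk n) W h1
  let f : (U ⊓ V).obj n ⟶ ⟨(U.obj n).dim, W⟩ :=
    BGOpen.incl (((U.inf_le_right V) _).trans hV)
  refine ⟨U ⊓ V, U.inf_le_left V, (K.X q).obj.map f.op y, ?_⟩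
  refine (NatTrans.naturality_apply (K.d q (q + 1)).hom f.op y).trans ?_
  rw [hy, ← ConcreteCategory.comp_apply, ← Functor.map_comp, ← op_comp]
  congr 4

end IdentityNhd

end

/-! ### Ladders: zigzags in the double complex of sections of a resolution -/

section

variable {G : Type u} [Group G] [TopologicalSpace G] [IsTopologicalGroup G]

namespace IdentityNhd

/-- The sections of a simplicial sheaf over the member of degree `n`. -/
abbrev Sec (F : Sheaf (bgTopology G) AddCommGrpCat.{u}) (U : IdentityNhd G) (n : ℕ) : Type u :=
  F.obj.obj (op (U.obj n))

variable {U V W : IdentityNhd G} {F F' F'' : Sheaf (bgTopology G) AddCommGrpCat.{u}}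

/-- The map induced on sections by a morphism of simplicial sheaves. -/
def secMap (f : F ⟶ F') (U : IdentityNhd G) (n : ℕ) : Sec F U n →+ Sec F' U n :=
  ConcreteCategory.hom (f.hom.app (op (U.obj n)))

/-- Restriction to a smaller simplicial neighbourhood. -/
def res (F : Sheaf (bgTopology G) AddCommGrpCat.{u}) (h : U ≤ V) (n : ℕ) :
    Sec F V n →+ Sec F U n :=
  ConcreteCategory.hom (F.obj.map (incl h n).op)

/-- The simplicial differential on sections of a simplicial sheaf. -/
def secD (F : Sheaf (bgTopology G) AddCommGrpCat.{u}) (U : IdentityNhd G) (n : ℕ) :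
    Sec F U n →+ Sec F U (n + 1) :=
  U.faceD F.obj n

theorem secD_secD (n : ℕ) (x : Sec F U n) : secD F U (n + 1) (secD F U n x) = 0 :=
  faceD_faceD U F.obj n x

theorem secD_res (h : U ≤ V) (n : ℕ) (x : Sec F V n) :
    secD F U n (res F h n x) = res F h (n + 1) (secD F V n x) :=
  faceD_incl h F.obj n x

theorem secD_secMap (f : F ⟶ F') (n : ℕ) (x : Sec F U n) :
    secD F' U n (secMap f U n x) = secMap f U (n + 1) (secD F U n x) :=
  faceD_app f.hom n x

theorem secMap_res (f : F ⟶ F') (h : U ≤ V) (n : ℕ) (x : Sec F V n) :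
    secMap f U n (res F h n x) = res F' h n (secMap f V n x) :=
  NatTrans.naturality_apply f.hom (incl h n).op x

theorem res_res (h : U ≤ V) (h' : V ≤ W) (n : ℕ) (x : Sec F W n) :
    res F h n (res F h' n x) = res F (h.trans h') n x :=
  incl_incl h h' F.obj n x

theorem secMap_comp (f : F ⟶ F') (g : F' ⟶ F'') (n : ℕ) (x : Sec F U n) :
    secMap (f ≫ g) U n x = secMap g U n (secMap f U n x) :=
  rfl

variable (I : InjectiveResolution F)

/-- The coaugmentation of an injective resolution. -/
def aug : F ⟶ I.cocomplex.X 0 := I.ι.f 0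

/-- The differential of an injective resolution, on sections. -/
def vert (U : IdentityNhd G) (q n : ℕ) :
    Sec (I.cocomplex.X q) U n →+ Sec (I.cocomplex.X (q + 1)) U n :=
  secMap (I.cocomplex.d q (q + 1)) U n

theorem secD_vert (q n : ℕ) (x : Sec (I.cocomplex.X q) U n) :
    secD _ U n (vert I U q n x) = vert I U q (n + 1) (secD _ U n x) :=
  secD_secMap _ _ _

theorem vert_res (h : U ≤ V) (q n : ℕ) (x : Sec (I.cocomplex.X q) V n) :
    vert I U q n (res _ h n x) = res _ h n (vert I V q n x) :=
  secMap_res _ _ _ _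

theorem exists_vert_eq {q n : ℕ} (z : Sec (I.cocomplex.X (q + 1)) U n)
    (hz : vert I U (q + 1) n z = 0) :
    ∃ (V : IdentityNhd G) (h : V ≤ U) (y : Sec (I.cocomplex.X q) V n),
      vert I V q n y = res _ h n z :=
  exists_lift (I.exact_succ q) z hz

/-- Unlike in `exists_vert_eq`, no shrinking is needed: the coaugmentation is a monomorphism and
taking sections is left exact. -/
theorem exists_aug_eq {n : ℕ} (z : Sec (I.cocomplex.X 0) U n) (hz : vert I U 0 n z = 0) :
    ∃ a : Sec F U n, secMap (aug I) U n a = z :=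
  have : Mono (ShortComplex.mk _ _ I.ι_f_zero_comp_complex_d).f :=
    inferInstanceAs (Mono (I.ι.f 0))
  Sheaf.exists_section_of_exact_of_mono I.exact₀ _ z hz

theorem aug_injective (n : ℕ) : Function.Injective (secMap (aug I) U n) := by
  have : Mono (aug I) := inferInstanceAs (Mono (I.ι.f 0))
  let Γ : Sheaf (bgTopology G) AddCommGrpCat.{u} ⥤ AddCommGrpCat.{u} :=
    sheafToPresheaf _ _ ⋙ (evaluation _ _).obj (op (U.obj n))
  exact (AddCommGrpCat.mono_iff_injective (Γ.map (aug I))).1 inferInstance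

/-- `e` is a cochain of degree `n - 1` of the double complex of sections of the resolution, whose
total differential is the difference of `a` and `s`. -/
def IsLadder (U : IdentityNhd G) : ∀ n : ℕ, Sec (I.cocomplex.X n) U 0 → Sec F U n →
    (∀ q p, Sec (I.cocomplex.X q) U p) → Prop
  | 0, s, a, _ => secMap (aug I) U 0 a = s
  | m + 1, s, a, e => vert I U m 0 (e m 0) = -s ∧
      (∀ q p, q + p + 1 = m →
        vert I U q (p + 1) (e q (p + 1)) = (-1 : ℤ) ^ p • secD _ U p (e (q + 1) p)) ∧
      secD _ U m (e 0 m) = secMap (aug I) U (m + 1) a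

variable {I}

theorem IsLadder.sub {n : ℕ} {s s' : Sec (I.cocomplex.X n) U 0} {a a' : Sec F U n}
    {e e' : ∀ q p, Sec (I.cocomplex.X q) U p} (h : IsLadder I U n s a e)
    (h' : IsLadder I U n s' a' e') : IsLadder I U n (s - s') (a - a') (e - e') := by
  cases n with
  | zero =>
    rw [IsLadder] at *
    rw [map_sub, h, h']
  | succ m =>
    refine ⟨?_, fun q p hqp => ?_, ?_⟩
    · simp only [Pi.sub_apply, map_sub, h.1, h'.1]; abel
    · simp only [Pi.sub_apply, map_sub, h.2.1 q p hqp, h'.2.1 q p hqp, smul_sub]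
    · simp only [Pi.sub_apply, map_sub, h.2.2, h'.2.2]

theorem IsLadder.res {n : ℕ} {s : Sec (I.cocomplex.X n) V 0} {a : Sec F V n}
    {e : ∀ q p, Sec (I.cocomplex.X q) V p} (h : IsLadder I V n s a e) (hUV : U ≤ V) :
    IsLadder I U n (res _ hUV 0 s) (res _ hUV n a) (fun q p => res _ hUV p (e q p)) := by
  cases n with
  | zero =>
    rw [IsLadder] at *
    rw [secMap_res, h]
  | succ m =>
    refine ⟨?_, fun q p hqp => ?_, ?_⟩
    · rw [vert_res, h.1, map_neg]
    · rw [vert_res, h.2.1 q p hqp, secD_res, map_zsmul]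
    · rw [secD_res, h.2.2, secMap_res]

/-- When the ladder starts at an exact section, each entry can be replaced, without changing its
simplicial differential, by a vertically closed one. The correction moves down the staircase, one
shrinking per step, until it reaches resolution degree 0. -/
theorem exists_closed_of_ladder {m : ℕ} {s : Sec (I.cocomplex.X m) U 0} {a : Sec F U (m + 1)}
    {e : ∀ q p, Sec (I.cocomplex.X q) U p} (hs : secD _ U 0 s = 0)
    (h : IsLadder I U (m + 1) (vert I U m 0 s) a e) (k : ℕ) :
    ∀ q, q + k = m → ∃ (V : IdentityNhd G) (hV : V ≤ U) (z : Sec (I.cocomplex.X q) V k),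
      vert I V q k z = 0 ∧ secD _ V k z = IdentityNhd.res _ hV (k + 1) (secD _ U k (e q k)) := by
  induction k with
  | zero =>
    intro q hq
    -- The entry `e m 0` has vertical differential `-vert s`, so adding s makes it closed; since s
    -- has zero simplicial differential, that of the entry is unchanged.
    obtain rfl : m = q := hq.symm
    refine ⟨U, le_rfl, IdentityNhd.res _ le_rfl 0 (e m 0 + s), ?_, ?_⟩
    · rw [vert_res, map_add, h.1]; simp
    · rw [secD_res, map_add, hs, add_zero]
  | succ k ih =>
    intro q hq
    obtain ⟨V, hV, z, hz, hDz⟩ := ih (q + 1) (by omega)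
    obtain ⟨W, hW, y, hy⟩ := exists_vert_eq I z hz
    -- With z = dy, subtracting (-1)^k δy kills the vertical differential, because δz agrees with δe
    -- at the previous entry; δδ = 0 leaves the simplicial differential alone.
    refine ⟨W, hW.trans hV,
      IdentityNhd.res _ (hW.trans hV) (k + 1) (e q (k + 1)) - (-1 : ℤ) ^ k • secD _ W k y, ?_, ?_⟩
    · rw [map_sub, vert_res, h.2.1 q k (by omega), map_zsmul, map_zsmul, ← secD_vert, hy,
        secD_res, hDz, res_res, sub_self]
    · rw [map_sub, map_zsmul, secD_secD, smul_zero, sub_zero, secD_res]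

/-- In a ladder over an exact global section, the top component is locally a coboundary. -/
theorem IsLadder.exists_secD_eq {m : ℕ} {s : Sec (I.cocomplex.X m) U 0} {a : Sec F U (m + 1)}
    {e : ∀ q p, Sec (I.cocomplex.X q) U p} (hs : secD _ U 0 s = 0)
    (h : IsLadder I U (m + 1) (vert I U m 0 s) a e) :
    ∃ (V : IdentityNhd G) (hV : V ≤ U) (c : Sec F V m),
      secD F V m c = IdentityNhd.res F hV (m + 1) a := by
  obtain ⟨V, hV, z, hz, hDz⟩ := exists_closed_of_ladder hs h m 0 (zero_add m)
  -- The corrected entry in resolution degree 0 comes from a section c of F. Both δc and a have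
  -- image δ(e 0 m) under the injective coaugmentation.
  obtain ⟨c, rfl⟩ := exists_aug_eq I z hz
  refine ⟨V, hV, c, aug_injective I _ ?_⟩
  rw [← secD_secMap, hDz, h.2.2, secMap_res]

-- This is the part of a ladder from bidegree (q, k) down to (0, m), built by induction on the
-- resolution degree q: lift z to y, then continue with δy. The simplicial degree k and the
-- neighbourhood change at each step, so both are quantified inside the induction.
variable (I) in
theorem exists_partial_ladder (q : ℕ) : ∀ (k m : ℕ), q + k = m → ∀ (U : IdentityNhd G)
    (z : Sec (I.cocomplex.X (q + 1)) U k), vert I U (q + 1) k z = 0 → secD _ U k z = 0 →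
    ∃ (V : IdentityNhd G) (hV : V ≤ U) (a : Sec F V (m + 1))
      (e : ∀ q p, Sec (I.cocomplex.X q) V p), vert I V q k (e q k) = IdentityNhd.res _ hV k z ∧
      (∀ q p, q + p + 1 = m → k ≤ p →
        vert I V q (p + 1) (e q (p + 1)) = (-1 : ℤ) ^ p • secD _ V p (e (q + 1) p)) ∧
      secD _ V m (e 0 m) = secMap (aug I) V (m + 1) a := by
  induction q with
  | zero =>
    intro k m hm U z hz hDz
    obtain rfl : k = m := by omega
    obtain ⟨V, hV, y, hy⟩ := exists_vert_eq I z hz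
    obtain ⟨a, ha⟩ := exists_aug_eq I (secD _ V k y)
      (by rw [← secD_vert, hy, secD_res, hDz, map_zero])
    -- Here k = m, so a single entry suffices and the intermediate relations are vacuous.
    refine ⟨V, hV, a, Pi.single 0 (Pi.single k y), ?_, fun q p h1 h2 => by omega, ?_⟩
    · simpa using hy
    · simpa using ha.symm
  | succ q ih =>
    intro k m hm U z hz hDz
    obtain ⟨V, hV, y, hy⟩ := exists_vert_eq I z hz
    obtain ⟨W, hW, a, e, h1, h2, h3⟩ := ih (k + 1) m (by omega) V ((-1 : ℤ) ^ k • secD _ V k y)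
      (by rw [map_zsmul, ← secD_vert, hy, secD_res, hDz, map_zero, smul_zero])
      (by rw [map_zsmul, secD_secD, smul_zero])
    -- The induction hypothesis imposes nothing on the entry (q + 1, k), since its relations start
    -- at simplicial degree k + 1; that entry may be overwritten by y.
    refine ⟨W, hW.trans hV, a, Function.update e (q + 1)
      (Function.update (e (q + 1)) k (IdentityNhd.res _ hW k y)), ?_, fun q' p hp hkp => ?_, ?_⟩
    · simp only [Function.update_self]
      rw [vert_res, hy, res_res]
    · have hne : p + 1 ≠ k := by omega
      have h4 : Function.update e (q + 1)
          (Function.update (e (q + 1)) k (IdentityNhd.res _ hW k y)) q' (p + 1) = e q' (p + 1) := by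
        by_cases hq : q' = q + 1
        · subst hq
          rw [Function.update_self, Function.update_of_ne hne]
        · rw [Function.update_of_ne hq]
      rw [h4]
      obtain rfl | hlt := hkp.eq_or_lt
      · obtain rfl : q' = q := by omega
        simp only [Function.update_self]
        rw [h1, map_zsmul, secD_res]
      · rw [h2 q' p hp hlt]
        by_cases hq : q' = q
        · subst hq
          rw [Function.update_self, Function.update_of_ne hlt.ne']
        · rw [Function.update_of_ne (by omega)]
    · rw [Function.update_of_ne (by omega), h3]

variable (I) in
/-- Every closed global section of a resolution is the start of a ladder. -/
theorem exists_isLadder (n : ℕ) (U : IdentityNhd G) (s : Sec (I.cocomplex.X n) U 0)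
    (hs : vert I U n 0 s = 0) (hDs : secD _ U 0 s = 0) :
    ∃ (V : IdentityNhd G) (hV : V ≤ U) (a : Sec F V n) (e : ∀ q p, Sec (I.cocomplex.X q) V p),
      IsLadder I V n (IdentityNhd.res _ hV 0 s) a e := by
  cases n with
  | zero =>
    obtain ⟨a, ha⟩ := exists_aug_eq I s hs
    exact ⟨U, le_rfl, IdentityNhd.res _ le_rfl 0 a, 0, by rw [IsLadder, secMap_res, ha]⟩
  | succ m =>
    -- The sign comes from the normalization of a ladder: its total differential is a minus s.
    obtain ⟨V, hV, a, e, h1, h2, h3⟩ := exists_partial_ladder I m 0 m rfl U (-s)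
      (by rw [map_neg, hs, neg_zero]) (by rw [map_neg, hDs, neg_zero])
    exact ⟨V, hV, a, e, by rw [h1, map_neg], fun q p h => h2 q p h (Nat.zero_le p), h3⟩

end IdentityNhd

end

/-! ### Germs at the unit -/

section

variable (E : Type*) [AddCommGroup E] [Module ℝ E] [TopologicalSpace E] [FrechetSpace E]
  (EA : Type*) [AddCommGroup EA] [Module ℝ EA] [TopologicalSpace EA] [FrechetSpace EA]
  {G : Type u} [Group G] [TopologicalSpace G] [IsTopologicalGroup G] [ChartedSpace E G]
  [FrechetLieGroup E G]
  (A : Type u) [AddCommGroup A] [TopologicalSpace A] [IsTopologicalAddGroup A]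
  [ChartedSpace EA A] [FrechetAddLieGroup EA A] [DistribMulAction G A] [SmoothAction E EA G A]

/-- The germ at `1` of a section of the sheaf of smooth `A`-valued functions. -/
noncomputable def coeffGerm (X : BGOpen G) (h : 1 ∈ X.carrier) :
    (coeffSheaf E EA G A).obj.obj (op X) →+ smoothGerms E EA G A X.dim.len where
  toFun s := sectionGerm E EA A X.carrier h s
  map_zero' := Subtype.ext (congrArg Germ.ofFun (funext fun g => by
    by_cases hg : g ∈ X.carrier
    · rw [dif_pos hg]; rfl
    · rw [dif_neg hg]))
  map_add' s t := Subtype.ext (congrArg Germ.ofFun (funext fun g => by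
    by_cases hg : g ∈ X.carrier
    · simp only [dif_pos hg]; rfl
    · simp only [dif_neg hg]; exact (add_zero 0).symm))

theorem coeffGerm_map {X Y : BGOpen G} (f : Y ⟶ X) (hX : 1 ∈ X.carrier) (hY : 1 ∈ Y.carrier)
    (s : (coeffSheaf E EA G A).obj.obj (op X)) :
    (coeffGerm E EA A Y hY ((coeffSheaf E EA G A).obj.map f.op s)).1 =
      germPull G A f.map (coeffGerm E EA A X hX s).1 := by
  refine Germ.coe_eq.2 ?_
  filter_upwards [Y.carrier.isOpen.mem_nhds hY] with g hg
  have hg' : g ∈ Y.carrier := hg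
  have hg'' : bgMap f.map g ∈ X.carrier := f.mapsTo g hg
  simp only [dif_pos hg', Function.comp_apply, dif_pos hg'']
  rfl

theorem germPull_id (n : SimplexCategory) (γ : Germ (𝓝 (1 : Fin n.len → G)) A) :
    germPull G A (𝟙 n) γ = γ := by
  induction γ using Germ.inductionOn with | _ f
  refine congrArg Germ.ofFun (funext fun g => ?_)
  change Fin.partialProd g 0 • f (bgMap (𝟙 n) g) = f g
  rw [Fin.partialProd_zero, one_smul, bgMap_id]

/-- The morphism is arbitrary over the identity operator, so that the lemma applies to `incl`,
`omitHom` and `toCell` alike. -/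
theorem coeffGerm_incl {n : SimplexCategory} {V U : Opens (Fin n.len → G)}
    (f : (⟨n, V⟩ : BGOpen G) ⟶ ⟨n, U⟩) (hf : f.map = 𝟙 n) (hU : 1 ∈ U) (hV : 1 ∈ V)
    (s : (coeffSheaf E EA G A).obj.obj (op ⟨n, U⟩)) :
    coeffGerm E EA A ⟨n, V⟩ hV ((coeffSheaf E EA G A).obj.map f.op s) =
      coeffGerm E EA A ⟨n, U⟩ hU s := by
  refine Subtype.ext ((coeffGerm_map E EA A f hU hV s).trans ?_)
  rw [hf]
  exact germPull_id A n _

theorem localD_val (n : ℕ) (γ : smoothGerms E EA G A n) :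
    (localD E EA G A n γ).1 = ∑ k : Fin (n + 2), (-1 : ℤ) ^ (k : ℕ) •
      germPull G A (SimplexCategory.δ (n := n) k) γ.1 := by
  simp only [localD, AddMonoidHom.codRestrict_apply, AddMonoidHom.comp_apply,
    AddMonoidHom.finsetSum_apply, AddMonoidHom.smul_apply]
  rfl

open IdentityNhd

/-- The germ at `1` of a smooth function on a simplicial neighbourhood. -/
noncomputable def secGerm (U : IdentityNhd G) (n : ℕ) :
    Sec (coeffSheaf E EA G A) U n →+ smoothGerms E EA G A n :=
  coeffGerm E EA A (U.obj n) (U.one_mem _)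

theorem secGerm_res {U V : IdentityNhd G} (h : U ≤ V) (n : ℕ) (c : Sec (coeffSheaf E EA G A) V n) :
    secGerm E EA A U n (IdentityNhd.res _ h n c) = secGerm E EA A V n c :=
  coeffGerm_incl E EA A (incl h n) rfl _ _ c

theorem localD_secGerm (U : IdentityNhd G) (n : ℕ) (c : Sec (coeffSheaf E EA G A) U n) :
    localD E EA G A n (secGerm E EA A U n c) = secGerm E EA A U (n + 1) (secD _ U n c) := by
  refine Subtype.ext ?_
  rw [localD_val, secD, faceD_apply, map_sum, AddSubgroup.val_finsetSum]
  refine Finset.sum_congr rfl fun k _ => ?_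
  rw [map_zsmul]
  exact congrArg ((-1 : ℤ) ^ (k : ℕ) • ·)
    (coeffGerm_map E EA A (U.face n k) (U.one_mem _) (U.one_mem _) c).symm

/-- This reduces identities between germs to identities between sections; `localCoboundaries_le`
obtains the vanishing of the squared local differential in this way. -/
theorem exists_secGerm_eq (n : ℕ) (γ : smoothGerms E EA G A n) :
    ∃ (U : IdentityNhd G) (c : Sec (coeffSheaf E EA G A) U n), secGerm E EA A U n c = γ := by
  obtain ⟨_, f, O, hO, h1, hf, rfl⟩ := γ
  obtain ⟨U, hU⟩ := exists_opens_le (SimplexCategory.mk n) ⟨O, hO⟩ h1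
  let c : smoothSections E EA A (U.obj n).carrier := ⟨fun x => f x.1, f, hf.mono hU, fun _ => rfl⟩
  refine ⟨U, c, Subtype.ext (Germ.coe_eq.2 ?_)⟩
  filter_upwards [(U.obj n).carrier.isOpen.mem_nhds (U.one_mem _)] with g hg
  have hg' : g ∈ (U.obj n).carrier := hg
  exact dif_pos hg'

theorem localCoboundaries_le (n : ℕ) :
    localCoboundaries E EA G A n ≤ localCocycles E EA G A n := by
  cases n with
  | zero => exact bot_le
  | succ n =>
    rintro _ ⟨γ, rfl⟩
    obtain ⟨U, c, rfl⟩ := exists_secGerm_eq E EA A n γ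
    change localD _ _ _ _ _ _ = 0
    rw [localD_secGerm, localD_secGerm, secD_secD, map_zero]

/-! ### Čech cocycles at distinguished indices -/

namespace SimplicialOpens

variable {𝒰 : SimplicialOpens.{u, w} G}

theorem one_mem_cell {n : SimplexCategory} {r : ℕ} {j : Fin (r + 1) → 𝒰.index.obj (op n)}
    (h : ∀ l, 1 ∈ 𝒰.opens n (j l)) : 1 ∈ (𝒰.cell j).carrier :=
  mem_iInter.2 h

/-- The germ at `1` of a component of a Čech cochain. -/
noncomputable def cochainGerm (g : 𝒰.Cochain (coeffSheaf E EA G A)) (p r : ℕ)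
    (j : Fin (r + 1) → 𝒰.index.obj (op (SimplexCategory.mk p)))
    (h : ∀ l, 1 ∈ 𝒰.opens _ (j l)) : smoothGerms E EA G A p :=
  coeffGerm E EA A (𝒰.cell j) (one_mem_cell h) (g p r j)

variable {E EA A} (g : 𝒰.Cochain (coeffSheaf E EA G A))

theorem cochainGerm_congr {p r : ℕ} {j j' : Fin (r + 1) → 𝒰.index.obj (op (SimplexCategory.mk p))}
    (hj : j = j') (h : ∀ l, 1 ∈ 𝒰.opens _ (j l)) (h' : ∀ l, 1 ∈ 𝒰.opens _ (j' l)) :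
    cochainGerm E EA A g p r j h = cochainGerm E EA A g p r j' h' := by
  subst hj; rfl

/-- If all faces of the tuple j are the same tuple j', the summands are pull-backs of one and the
same germ and assemble to its local differential. This is the purpose of requiring equal faces in
`Distinguished`. -/
theorem cochainGerm_simplicialD {p r : ℕ}
    {j : Fin (r + 1) → 𝒰.index.obj (op (SimplexCategory.mk (p + 1)))}
    (h : ∀ l, 1 ∈ 𝒰.opens _ (j l))
    {j' : Fin (r + 1) → 𝒰.index.obj (op (SimplexCategory.mk p))}
    (h' : ∀ l, 1 ∈ 𝒰.opens _ (j' l)) (hj : ∀ k l, 𝒰.index.δ k (j l) = j' l) :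
    cochainGerm E EA A (simplicialD g) (p + 1) r j h =
      localD E EA G A p (cochainGerm E EA A g p r j' h') := by
  refine Subtype.ext ?_
  rw [localD_val, cochainGerm, simplicialD, map_sum, AddSubgroup.val_finsetSum]
  refine Finset.sum_congr rfl fun k _ => ?_
  rw [map_zsmul]
  have h'' : ∀ l, 1 ∈ 𝒰.opens _ (𝒰.index.δ k (j l)) := fun l => by rw [hj]; exact h' l
  rw [← cochainGerm_congr g (funext (hj k)) h'' h']
  exact congrArg ((-1 : ℤ) ^ (k : ℕ) • ·)
    (coeffGerm_map E EA A (𝒰.faceHom j k) (one_mem_cell h'') (one_mem_cell h) _)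

theorem cochainGerm_cechD {p r : ℕ}
    {j : Fin (r + 2) → 𝒰.index.obj (op (SimplexCategory.mk p))}
    (h : ∀ l, 1 ∈ 𝒰.opens _ (j l)) :
    cochainGerm E EA A (cechD g) p (r + 1) j h = ∑ k : Fin (r + 2), (-1 : ℤ) ^ (k : ℕ) •
      cochainGerm E EA A g p r (fun l => j (k.succAbove l)) (fun _ => h _) := by
  rw [cochainGerm, cechD, map_sum]
  refine Finset.sum_congr rfl fun k _ => ?_
  rw [map_zsmul]
  exact congrArg ((-1 : ℤ) ^ (k : ℕ) • ·) (coeffGerm_incl E EA A (𝒰.omitHom j k) rfl _ _ _)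

theorem cochainGerm_totalD (p r : ℕ)
    (j : Fin (r + 1) → 𝒰.index.obj (op (SimplexCategory.mk p)))
    (h : ∀ l, 1 ∈ 𝒰.opens _ (j l)) :
    cochainGerm E EA A (totalD g) p r j h = cochainGerm E EA A (simplicialD g) p r j h +
      (-1 : ℤ) ^ p • cochainGerm E EA A (cechD g) p r j h := by
  refine (map_add (coeffGerm E EA A (𝒰.cell j) (one_mem_cell h)) _ _).trans ?_
  exact congrArg _ (map_zsmul _ _ _)

variable {g}

theorem IsCocycle.cochainGerm_eq_zero {n : ℕ} (hg : IsCocycle n g) (p r : ℕ)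
    (j : Fin (r + 1) → 𝒰.index.obj (op (SimplexCategory.mk p)))
    (h : ∀ l, 1 ∈ 𝒰.opens _ (j l)) : cochainGerm E EA A (totalD g) p r j h = 0 := by
  rw [cochainGerm, hg.2]
  exact map_zero _

theorem cochainGerm_cechD_pair (g : 𝒰.Cochain (coeffSheaf E EA G A)) {p : ℕ}
    {i i' : 𝒰.index.obj (op (SimplexCategory.mk p))}
    (hi : 1 ∈ 𝒰.opens _ i) (hi' : 1 ∈ 𝒰.opens _ i') (h : ∀ l, 1 ∈ 𝒰.opens _ (![i, i'] l)) :
    cochainGerm E EA A (cechD g) p 1 ![i, i'] h =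
      cochainGerm E EA A g p 0 (fun _ => i') (fun _ => hi') -
        cochainGerm E EA A g p 0 (fun _ => i) (fun _ => hi) := by
  rw [cochainGerm_cechD, Fin.sum_univ_two, sub_eq_add_neg]
  congr 1
  · rw [Fin.val_zero, pow_zero, one_smul]
    refine cochainGerm_congr g (funext fun l => ?_) _ _
    fin_cases l; rfl
  · rw [Fin.val_one, pow_one, neg_smul, one_smul]
    refine congrArg _ (cochainGerm_congr g (funext fun l => ?_) _ _)
    fin_cases l; rfl

/-- The germs of a cocycle at two distinguished indices are cohomologous. -/
theorem IsCocycle.topGerm_sub_mem {n : ℕ} (hg : IsCocycle n g)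
    {i i' : 𝒰.index.obj (op (SimplexCategory.mk n))} (hi : 𝒰.Distinguished n i)
    (hi' : 𝒰.Distinguished n i') :
    topGerm E EA A g i hi - topGerm E EA A g i' hi' ∈ localCoboundaries E EA G A n := by
  change cochainGerm E EA A g n 0 (fun _ => i) (fun _ => hi.one_mem) -
    cochainGerm E EA A g n 0 (fun _ => i') (fun _ => hi'.one_mem) ∈ _
  have h1 : ∀ l, 1 ∈ 𝒰.opens _ (![i, i'] l) := Fin.forall_fin_two.2 ⟨hi.one_mem, hi'.one_mem⟩
  -- The component of the cocycle identity in bidegree (n, 1), on the intersection of the two open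
  -- sets, contains the difference of the two top germs.
  have h := hg.cochainGerm_eq_zero n 1 ![i, i'] h1
  rw [cochainGerm_totalD, cochainGerm_cechD_pair g hi.one_mem hi'.one_mem] at h
  cases n with
  | zero =>
    -- Nothing maps simplicially into degree 0, so here the two germs are equal.
    have h0 : cochainGerm E EA A (simplicialD g) 0 1 ![i, i'] h1 = 0 := map_zero _
    rw [h0, zero_add, pow_zero, one_smul] at h
    rw [← neg_sub, h, neg_zero]
    exact AddSubgroup.zero_mem _
  | succ n =>
    have h2 : ∀ l, 1 ∈ 𝒰.opens _ (𝒰.index.δ 0 (![i, i'] l)) := fun l => by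
      have := 𝒰.mapsTo (SimplexCategory.δ 0) _ _ (h1 l)
      rwa [bgMap_one] at this
    rw [cochainGerm_simplicialD g h1 (j' := fun l => 𝒰.index.δ 0 (![i, i'] l)) h2] at h
    · rw [← neg_sub, smul_neg, add_neg_eq_zero] at h
      -- The factor cancels the sign of the Čech differential in `totalD` in simplicial degree n +
      -- 1.
      refine ⟨(-1 : ℤ) ^ (n + 1) •
        cochainGerm E EA A g n 1 (fun l => 𝒰.index.δ 0 (![i, i'] l)) h2, ?_⟩
      rw [map_zsmul, h, smul_smul, ← mul_pow, neg_one_mul, neg_neg, one_pow, one_smul]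
    · intro k
      exact Fin.forall_fin_two.2 ⟨hi.2 k 0, hi'.2 k 0⟩

/-- The totally degenerate index over a vertex. -/
def degen (𝒰 : SimplicialOpens.{u, w} G) (v : 𝒰.index.obj (op (SimplexCategory.mk 0)))
    (n : SimplexCategory) : 𝒰.index.obj (op n) :=
  𝒰.index.map (SimplexCategory.isTerminalZero.from n).op v

/-- Since [0] is terminal in the simplex category, an operator followed by the map to [0] is again
the map to [0]. In particular all faces of a totally degenerate index agree. -/
theorem map_degen (v : 𝒰.index.obj (op (SimplexCategory.mk 0))) {m n : SimplexCategory}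
    (φ : m ⟶ n) : 𝒰.index.map φ.op (𝒰.degen v n) = 𝒰.degen v m := by
  rw [degen, degen, ← ConcreteCategory.comp_apply, ← Functor.map_comp, ← op_comp,
    SimplexCategory.isTerminalZero.hom_ext (φ ≫ _) (SimplexCategory.isTerminalZero.from m)]

theorem one_mem_degen {v : 𝒰.index.obj (op (SimplexCategory.mk 0))} (hv : 1 ∈ 𝒰.opens _ v)
    (n : SimplexCategory) : 1 ∈ 𝒰.opens n (𝒰.degen v n) := by
  have := 𝒰.mapsTo (SimplexCategory.isTerminalZero.from n) _ _ hv
  rwa [bgMap_one] at this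

theorem distinguished_degen {v : 𝒰.index.obj (op (SimplexCategory.mk 0))} (hv : 1 ∈ 𝒰.opens _ v)
    (n : ℕ) : 𝒰.Distinguished n (𝒰.degen v (SimplexCategory.mk n)) := by
  cases n with
  | zero => exact one_mem_degen hv _
  | succ n => exact ⟨one_mem_degen hv _, fun k l =>
      (map_degen v (SimplexCategory.δ k)).trans (map_degen v (SimplexCategory.δ l)).symm⟩

theorem IsCovering.exists_distinguished (h : 𝒰.IsCovering) (n : ℕ) : ∃ i, 𝒰.Distinguished n i := by
  obtain ⟨v, hv⟩ := h (SimplexCategory.mk 0) 1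
  exact ⟨_, distinguished_degen hv n⟩

/-- The family need not be a covering, so a vertex whose open set contains 1 is taken from i itself;
operators fix the unit. -/
theorem Distinguished.exists_vertex {n : ℕ} {i : 𝒰.index.obj (op (SimplexCategory.mk n))}
    (hi : 𝒰.Distinguished n i) :
    ∃ v : 𝒰.index.obj (op (SimplexCategory.mk 0)), 1 ∈ 𝒰.opens _ v := by
  refine ⟨𝒰.index.map (SimplexCategory.const (SimplexCategory.mk 0) (SimplexCategory.mk n) 0).op i,
    ?_⟩
  have := 𝒰.mapsTo (SimplexCategory.const (SimplexCategory.mk 0) (SimplexCategory.mk n) 0) _ _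
    hi.one_mem
  rwa [bgMap_one] at this

/-- The degenerate index of degree n is every face of the one of degree n + 1, so the cocycle
identity in bidegree (n + 1, 0) says exactly that the germ is closed. -/
theorem IsCocycle.topGerm_degen_mem {n : ℕ} (hg : IsCocycle n g)
    {v : 𝒰.index.obj (op (SimplexCategory.mk 0))} (hv : 1 ∈ 𝒰.opens _ v) :
    topGerm E EA A g _ (distinguished_degen hv n) ∈ localCocycles E EA G A n := by
  have h := hg.cochainGerm_eq_zero (n + 1) 0 (fun _ => 𝒰.degen v _) (fun _ => one_mem_degen hv _)
  rw [cochainGerm_totalD, cochainGerm_simplicialD g _ (fun _ => one_mem_degen hv _)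
    (fun k _ => map_degen v (SimplexCategory.δ k))] at h
  have h0 : cochainGerm E EA A (cechD g) (n + 1) 0 (fun _ => 𝒰.degen v _)
    (fun _ => one_mem_degen hv _) = 0 := map_zero _
  rw [h0, smul_zero, add_zero] at h
  exact h

/-- The germ of a cocycle at a distinguished index is a local cocycle. -/
theorem IsCocycle.topGerm_mem {n : ℕ} (hg : IsCocycle n g)
    {i : 𝒰.index.obj (op (SimplexCategory.mk n))} (hi : 𝒰.Distinguished n i) :
    topGerm E EA A g i hi ∈ localCocycles E EA G A n := by
  -- A distinguished index need not be the common face of an index one degree higher, so closedness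
  -- is deduced by comparison with a degenerate index.
  obtain ⟨v, hv⟩ := hi.exists_vertex
  have h := (hg.topGerm_sub_mem hi (distinguished_degen hv n))
  have := AddSubgroup.add_mem _ (localCoboundaries_le E EA A n h) (hg.topGerm_degen_mem hv)
  rwa [sub_add_cancel] at this

end SimplicialOpens

end

/-! ### Global sections, and Čech data restricted to degenerate indices -/

section

variable {G : Type u} [Group G] [TopologicalSpace G] [IsTopologicalGroup G]
  {F F' : Sheaf (bgTopology G) AddCommGrpCat.{u}}

/-- The constant sheaf `ℤ` on `BG`. -/
noncomputable abbrev intSheaf (G : Type u) [Group G] [TopologicalSpace G] [IsTopologicalGroup G] :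
    Sheaf (bgTopology G) AddCommGrpCat.{u} :=
  (constantSheaf (bgTopology G) AddCommGrpCat.{u}).obj (AddCommGrpCat.of (ULift.{u} ℤ))

theorem map_oneSection {X Y : BGOpen G} (f : Y ⟶ X) :
    (intSheaf G).obj.map f.op (SimplicialOpens.oneSection X) = SimplicialOpens.oneSection Y :=
  (NatTrans.naturality_apply (toSheafify (bgTopology G)
    ((Functor.const _).obj (AddCommGrpCat.of (ULift.{u} ℤ)))) f.op
    (ULift.up 1 : ULift.{u} ℤ)).symm

namespace IdentityNhd

variable {U V : IdentityNhd G}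

/-- The value of a global section over the member of degree zero of a simplicial neighbourhood. -/
noncomputable def globalSec (U : IdentityNhd G) (s : intSheaf G ⟶ F) : Sec F U 0 :=
  secMap s U 0 (SimplicialOpens.oneSection (U.obj 0))

theorem res_globalSec (h : U ≤ V) (s : intSheaf G ⟶ F) :
    res F h 0 (V.globalSec s) = U.globalSec s := by
  rw [globalSec, ← secMap_res]
  exact congrArg _ (map_oneSection _)

theorem secMap_globalSec (s : intSheaf G ⟶ F) (f : F ⟶ F') :
    secMap f U 0 (U.globalSec s) = U.globalSec (s ≫ f) :=
  rfl

/-- Both face maps pull the section 1 of the constant sheaf back to 1, and the two terms have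
opposite signs. -/
theorem secD_globalSec (s : intSheaf G ⟶ F) : secD F U 0 (U.globalSec s) = 0 := by
  rw [globalSec, secD_secMap, secD, faceD_apply, Fin.sum_univ_two]
  have h : ∀ k, (intSheaf G).obj.map (U.face 0 k).op (SimplicialOpens.oneSection (U.obj 0)) =
    SimplicialOpens.oneSection (U.obj 1) := fun k => map_oneSection _
  rw [h, h]
  simp

theorem globalSec_sub (s t : intSheaf G ⟶ F) :
    U.globalSec (s - t) = U.globalSec s - U.globalSec t :=
  rfl

theorem globalSec_zero : U.globalSec (0 : intSheaf G ⟶ F) = 0 :=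
  rfl

/-- Changing the resolution leaves a, hence its germ, untouched. This allows all classes to be
treated in one fixed resolution. -/
theorem IsLadder.map {I I' : InjectiveResolution F} (φ : I'.cocomplex ⟶ I.cocomplex)
    (hφ : aug I' ≫ φ.f 0 = aug I) {n : ℕ} {s : Sec (I'.cocomplex.X n) U 0} {a : Sec F U n}
    {e : ∀ q p, Sec (I'.cocomplex.X q) U p} (h : IsLadder I' U n s a e) :
    IsLadder I U n (secMap (φ.f n) U 0 s) a (fun q p => secMap (φ.f q) U p (e q p)) := by
  have hv : ∀ q p (x : Sec (I'.cocomplex.X q) U p), vert I U q p (secMap (φ.f q) U p x) =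
      secMap (φ.f (q + 1)) U p (vert I' U q p x) := fun q p x => by
    rw [vert, vert, ← secMap_comp, ← secMap_comp, φ.comm]
  have ha : ∀ p (x : Sec F U p), secMap (φ.f 0) U p (secMap (aug I') U p x) =
      secMap (aug I) U p x := fun p x => by
    rw [← secMap_comp, hφ]
  cases n with
  | zero =>
    rw [IsLadder] at *
    rw [← h, ha]
  | succ m =>
    refine ⟨?_, fun q p hqp => ?_, ?_⟩
    · rw [hv, h.1, map_neg]
    · rw [hv, h.2.1 q p hqp, map_zsmul, secD_secMap]
    · rw [secD_secMap, h.2.2, ha]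

/-- The coaugmentation is injective and sends a to a simplicial coboundary, or to s itself in degree
0. -/
theorem IsLadder.secD_eq_zero {I : InjectiveResolution F} {n : ℕ}
    {s : Sec (I.cocomplex.X n) U 0} {a : Sec F U n}
    {e : ∀ q p, Sec (I.cocomplex.X q) U p} (h : IsLadder I U n s a e) (hs : secD _ U 0 s = 0) :
    secD F U n a = 0 := by
  refine aug_injective I _ ?_
  rw [← secD_secMap, map_zero]
  cases n with
  | zero =>
    rw [IsLadder] at h
    rw [h, hs]
  | succ m => rw [← h.2.2, secD_secD]

end IdentityNhd

namespace SimplicialOpens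

open IdentityNhd

variable {𝒰 : SimplicialOpens.{u, w} G} {v : 𝒰.index.obj (op (SimplexCategory.mk 0))}

/-- The simplicial neighbourhood formed by the members of a simplicial family with a totally
degenerate index. -/
def nhd (𝒰 : SimplicialOpens.{u, w} G) {v : 𝒰.index.obj (op (SimplexCategory.mk 0))}
    (hv : 1 ∈ 𝒰.opens _ v) : IdentityNhd G where
  opens n := 𝒰.opens n (𝒰.degen v n)
  one_mem n := one_mem_degen hv n
  mapsTo φ g hg := by
    have := 𝒰.mapsTo φ _ g hg
    rwa [map_degen] at this

variable (hv : 1 ∈ 𝒰.opens _ v)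

/-- The inclusion of a member with totally degenerate index into its intersection with itself. -/
def toCell (p : ℕ) :
    (𝒰.nhd hv).obj p ⟶ 𝒰.cell (r := 0) fun _ => 𝒰.degen v (SimplexCategory.mk p) :=
  BGOpen.incl fun _ hg => mem_iInter.2 fun _ => hg

/-- The component at the totally degenerate index of a Čech cochain. -/
def restrict (p : ℕ) (c : 𝒰.Cochain F) : Sec F (𝒰.nhd hv) p :=
  F.obj.map (toCell hv p).op (c p 0 fun _ => 𝒰.degen v _)

theorem restrict_simplicialD (p : ℕ) (c : 𝒰.Cochain F) :
    restrict hv (p + 1) (simplicialD c) = secD F _ p (restrict hv p c) := by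
  rw [restrict, simplicialD, map_sum, secD, faceD_apply]
  refine Finset.sum_congr rfl fun k _ => ?_
  rw [map_zsmul, restrict]
  refine congrArg ((-1 : ℤ) ^ (k : ℕ) • ·) ?_
  -- The face of a degenerate index equals a degenerate index only propositionally; a variable tuple
  -- j lets this equality be substituted in the type of the cochain component.
  have key : ∀ (j : Fin 1 → 𝒰.index.obj (op (SimplexCategory.mk p)))
      (hj : j = fun _ => 𝒰.degen v _) (f : (𝒰.nhd hv).obj (p + 1) ⟶ 𝒰.cell j),
      f.map = SimplexCategory.δ k → F.obj.map f.op (c p 0 j) =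
        F.obj.map ((𝒰.nhd hv).face p k).op (F.obj.map (toCell hv p).op
          (c p 0 fun _ => 𝒰.degen v _)) := by
    rintro j rfl f hf
    rw [← ConcreteCategory.comp_apply, ← Functor.map_comp, ← op_comp]
    have : f = (𝒰.nhd hv).face p k ≫ toCell hv p :=
      BGOpen.Hom.ext (hf.trans (Category.id_comp _).symm)
    rw [this]
  rw [← ConcreteCategory.comp_apply, ← Functor.map_comp, ← op_comp]
  exact key _ (funext fun _ => map_degen v (SimplexCategory.δ k)) _ (Category.comp_id _)

/-- The Čech differential has no component landing in Čech degree 0. Restriction to single indices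
therefore turns the triple complex into the double complex of ladders. -/
theorem totalD_zero_right (p : ℕ) (c : 𝒰.Cochain F) : totalD c p 0 = simplicialD c p 0 := by
  have h : cechD c p 0 = 0 := rfl
  rw [totalD, h, smul_zero, add_zero]

theorem restrict_totalD_zero (c : 𝒰.Cochain F) : restrict hv 0 (totalD c) = 0 := by
  rw [restrict, totalD_zero_right]
  exact map_zero _

theorem restrict_totalD_succ (p : ℕ) (c : 𝒰.Cochain F) :
    restrict hv (p + 1) (totalD c) = secD F _ p (restrict hv p c) := by
  rw [← restrict_simplicialD, restrict, totalD_zero_right]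
  rfl

theorem restrict_mapCochain (p : ℕ) (f : F ⟶ F') (c : 𝒰.Cochain F) :
    restrict hv p (mapCochain f c) = secMap f _ p (restrict hv p c) :=
  (NatTrans.naturality_apply f.hom (toCell hv p).op _).symm

variable {I : InjectiveResolution F}

/-- A trivialization in the triple complex restricts to a ladder at a totally degenerate index. -/
theorem isLadder_of_resolutionD {n : ℕ} {g : 𝒰.Cochain F} {s : intSheaf G ⟶ I.cocomplex.X n}
    {b : ∀ q, 𝒰.Cochain (I.cocomplex.X q)}
    (hb : resolutionD b = augment (I.ι.f 0) g - ofSection s) :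
    IsLadder I (𝒰.nhd hv) n ((𝒰.nhd hv).globalSec s) (restrict hv n g)
      (fun q p => restrict hv p (b q)) := by
  have hs : restrict hv 0 (ofSection s n : 𝒰.Cochain (I.cocomplex.X n)) =
      (𝒰.nhd hv).globalSec s := by
    rw [restrict]
    simp only [ofSection, Pi.single_eq_same]
    rw [← NatTrans.naturality_apply]
    exact congrArg _ (map_oneSection _)
  have key : ∀ q p, restrict hv p (resolutionD b q) =
      restrict hv p (augment (I.ι.f 0) g q) - restrict hv p (ofSection s q) := fun q p => by
    rw [hb]; exact map_sub _ _ _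
  have haug : ∀ p, restrict hv p (augment (I.ι.f 0) g 0) =
      secMap (aug I) _ p (restrict hv p g) := fun p => restrict_mapCochain hv p (aug I) g
  have haug_succ : ∀ q p, restrict hv p (augment (I.ι.f 0) g (q + 1)) = 0 :=
    fun q p => map_zero _
  have hsucc : ∀ q p, restrict hv p (resolutionD b (q + 1)) =
      restrict hv p (totalD (b (q + 1))) + (-1 : ℤ) ^ p • vert I _ q p (restrict hv p (b q)) :=
    fun q p => by
      rw [vert, ← restrict_mapCochain]
      refine (map_add _ _ _).trans (congrArg _ ?_)
      exact map_zsmul _ _ _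
  cases n with
  | zero =>
    have h := key 0 0
    rw [hs, resolutionD, restrict_totalD_zero, haug, eq_comm,
      sub_eq_zero] at h
    exact h
  | succ m =>
    -- The three conditions are the components of the trivialization identity in (resolution,
    -- simplicial) bidegrees (m + 1, 0), (q + 1, p + 1) and (0, m + 1), all in Čech degree 0.
    refine ⟨?_, fun q p hqp => ?_, ?_⟩
    · have h := key (m + 1) 0
      rw [hs, hsucc, restrict_totalD_zero, haug_succ, pow_zero, one_smul, zero_add,
        zero_sub] at h
      exact h
    · have h := key (q + 1) (p + 1)
      have h0 : restrict hv (p + 1)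
        (ofSection s (q + 1) : 𝒰.Cochain (I.cocomplex.X (q + 1))) = 0 := map_zero _
      rw [h0, hsucc, restrict_totalD_succ, haug_succ, sub_zero, pow_succ, mul_neg_one,
        neg_smul, add_neg_eq_zero] at h
      rw [h, smul_smul, ← mul_pow, neg_one_mul, neg_neg, one_pow, one_smul]
    · have h := key 0 (m + 1)
      have h0 : restrict hv (m + 1) (ofSection s 0 : 𝒰.Cochain (I.cocomplex.X 0)) = 0 :=
        map_zero _
      rw [h0, resolutionD, restrict_totalD_succ, haug, sub_zero] at h
      exact h

end SimplicialOpens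

/-! ### From ladders to Čech cocycles on one-index families -/

namespace IdentityNhd

open SimplicialOpens

/-- A simplicial neighbourhood as a simplicial family of open sets with a single index in each
degree. -/
def family (U : IdentityNhd G) : SimplicialOpens.{u, w} G where
  index := (Functor.const _).obj PUnit
  opens n _ := U.opens n
  mapsTo φ _ := U.mapsTo φ

variable (U : IdentityNhd G)

/-- The members of the one-index family lie in the simplicial neighbourhood. -/
def ofCell {p r : ℕ} (j : Fin (r + 1) → (family.{u, w} U).index.obj (op (SimplexCategory.mk p))) :
    (family.{u, w} U).cell j ⟶ U.obj p :=
  BGOpen.incl fun _ hg => mem_iInter.1 hg 0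

/-- Sections over the simplicial neighbourhood as Čech cochains of degree zero. -/
def toCochain (a : ∀ p, Sec F U p) : (family.{u, w} U).Cochain F
  | p, 0, j => F.obj.map (U.ofCell j).op (a p)
  | _, _ + 1, _ => 0

/-- The simplicial differential on sequences of sections. -/
def shiftD (a : ∀ p, Sec F U p) : ∀ p, Sec F U p
  | 0 => 0
  | p + 1 => secD F U p (a p)

variable {U}

theorem simplicialD_toCochain (a : ∀ p, Sec F U p) :
    simplicialD (toCochain.{u, w} U a) = toCochain U (shiftD U a) := by
  funext p r j
  match p, r with
  | 0, 0 => exact (map_zero _).symm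
  | 0, r + 1 => rfl
  | p + 1, 0 =>
    rw [simplicialD, toCochain, shiftD, secD, faceD_apply, map_sum]
    refine Finset.sum_congr rfl fun k _ => ?_
    rw [map_zsmul, toCochain, ← ConcreteCategory.comp_apply, ← ConcreteCategory.comp_apply,
      ← Functor.map_comp, ← Functor.map_comp, ← op_comp, ← op_comp]
    have : (family.{u, w} U).faceHom j k ≫ U.ofCell (fun l => (family.{u, w} U).index.δ k (j l)) =
        U.ofCell j ≫ U.face p k :=
      BGOpen.Hom.ext ((Category.id_comp _).trans (Category.comp_id _).symm)
    rw [this]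
  | p + 1, r + 1 =>
    rw [simplicialD]
    refine Finset.sum_eq_zero fun k _ => ?_
    rw [toCochain, map_zero, smul_zero]

/-- With a single open set in each degree, the two terms in Čech degree 1 restrict the same section
and cancel; higher up there is nothing to restrict. -/
theorem cechD_toCochain (a : ∀ p, Sec F U p) : cechD (toCochain.{u, w} U a) = 0 := by
  funext p r j
  match r with
  | 0 => rfl
  | 1 =>
    change ∑ k : Fin 2, _ = _
    rw [Fin.sum_univ_two, toCochain, toCochain, ← ConcreteCategory.comp_apply,
      ← ConcreteCategory.comp_apply, ← Functor.map_comp, ← Functor.map_comp, ← op_comp, ← op_comp]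
    have : (family.{u, w} U).omitHom j 0 ≫ U.ofCell (fun l => j (Fin.succAbove 0 l)) =
        (family.{u, w} U).omitHom j 1 ≫ U.ofCell (fun l => j (Fin.succAbove 1 l)) := rfl
    rw [this]
    simp
  | r + 2 =>
    rw [cechD]
    refine Finset.sum_eq_zero fun k _ => ?_
    rw [toCochain, map_zero, smul_zero]

theorem totalD_toCochain (a : ∀ p, Sec F U p) :
    totalD (toCochain.{u, w} U a) = toCochain U (shiftD U a) := by
  funext p r
  rw [totalD, cechD_toCochain, simplicialD_toCochain]
  change _ + (-1 : ℤ) ^ p • 0 = _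
  rw [smul_zero, add_zero]

theorem mapCochain_toCochain (f : F ⟶ F') (a : ∀ p, Sec F U p) :
    mapCochain f (toCochain.{u, w} U a) = toCochain U fun p => secMap f U p (a p) := by
  funext p r j
  match r with
  | 0 => exact NatTrans.naturality_apply f.hom _ _
  | r + 1 => exact map_zero _

end IdentityNhd

end

section

variable {G : Type u} [Group G] [TopologicalSpace G] [IsTopologicalGroup G]
  {F F' : Sheaf (bgTopology G) AddCommGrpCat.{u}}

namespace IdentityNhd

open SimplicialOpens

variable {U V : IdentityNhd G}

theorem toCochain_zero : toCochain.{u, w} U (0 : ∀ p, Sec F U p) = 0 := by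
  funext p r j
  match r with
  | 0 => exact map_zero _
  | r + 1 => rfl

theorem toCochain_add (a b : ∀ p, Sec F U p) :
    toCochain.{u, w} U (a + b) = toCochain U a + toCochain U b := by
  funext p r j
  match r with
  | 0 => exact map_add _ _ _
  | r + 1 => exact (add_zero 0).symm

theorem toCochain_sub (a b : ∀ p, Sec F U p) :
    toCochain.{u, w} U (a - b) = toCochain U a - toCochain U b := by
  funext p r j
  match r with
  | 0 => exact map_sub _ _ _
  | r + 1 => exact (sub_zero 0).symm

/-- The sign in `resolutionD` involves the Čech degree r, but only r = 0 contributes, which leaves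
the sign used in `ladderD`. -/
theorem smul_toCochain (a : ∀ p, Sec F U p) (p r : ℕ) :
    (-1 : ℤ) ^ (p + r) • toCochain.{u, w} U a p r =
      toCochain U (fun p => (-1 : ℤ) ^ p • a p) p r := by
  match r with
  | 0 => exact funext fun j => (map_zsmul _ _ _).symm
  | r + 1 => exact smul_zero ((-1 : ℤ) ^ (p + (r + 1)))

theorem toCochain_eq_zero {a : ∀ p, Sec F U p} {p r : ℕ} (h : r = 0 → a p = 0) :
    toCochain.{u, w} U a p r = 0 := by
  funext j
  match r with
  | 0 =>
    rw [toCochain, h rfl]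
    exact map_zero _
  | r + 1 => rfl

theorem isCocycle_toCochain {n : ℕ} {a : Sec F U n} (ha : secD F U n a = 0) :
    IsCocycle n (toCochain.{u, w} U (Pi.single n a)) := by
  refine ⟨fun p r hpr => toCochain_eq_zero fun hr => Pi.single_eq_of_ne (by omega) _, ?_⟩
  rw [totalD_toCochain, ← toCochain_zero]
  congr 1
  funext p
  match p with
  | 0 => rfl
  | p + 1 =>
    rw [shiftD]
    by_cases hp : p = n
    · subst hp
      rw [Pi.single_eq_same, ha]; rfl
    · rw [Pi.single_eq_of_ne hp, map_zero]; rfl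

variable {I : InjectiveResolution F}

/-- The components of the image of a global section in the triple complex. -/
noncomputable def sectionSeq {n : ℕ} (U : IdentityNhd G) (s : intSheaf G ⟶ I.cocomplex.X n) :
    ∀ q p, Sec (I.cocomplex.X q) U p
  | q, 0 => Pi.single (M := fun q => Sec (I.cocomplex.X q) U 0) n (U.globalSec s) q
  | _, _ + 1 => 0

theorem ofSection_eq_toCochain {n : ℕ} (s : intSheaf G ⟶ I.cocomplex.X n) (q : ℕ) :
    ofSection s q = toCochain.{u, w} U (sectionSeq U s q) := by
  funext p r j
  match p, r with
  | 0, 0 =>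
    rw [toCochain, sectionSeq]
    by_cases hq : q = n
    · subst hq
      simp only [ofSection, Pi.single_eq_same]
      refine Eq.trans (congrArg _ (map_oneSection (U.ofCell j)).symm) ?_
      exact NatTrans.naturality_apply s.hom (U.ofCell j).op _
    · simp only [ofSection]
      rw [Pi.single_eq_of_ne hq, Pi.single_eq_of_ne hq, map_zero]
      rfl
  | 0, r + 1 => rfl
  | p + 1, 0 => exact (map_zero _).symm
  | p + 1, r + 1 => rfl

/-- The components of the image of a section of the resolved sheaf in the triple complex. -/
def augSeq {n : ℕ} (I : InjectiveResolution F) (a : Sec F U n) :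
    ∀ q p, Sec (I.cocomplex.X q) U p
  | 0, p => secMap (aug I) U p (Pi.single (M := fun p => Sec F U p) n a p)
  | _ + 1, _ => 0

theorem augment_toCochain {n : ℕ} (a : Sec F U n) (q : ℕ) :
    augment (I.ι.f 0) (toCochain.{u, w} U (Pi.single n a)) q = toCochain U (augSeq I a q) := by
  match q with
  | 0 => exact mapCochain_toCochain (aug I) _
  | q + 1 => exact toCochain_zero.symm

/-- The total differential of the double complex of sections of the resolution. -/
def ladderD (I : InjectiveResolution F) (e : ∀ q p, Sec (I.cocomplex.X q) U p) :
    ∀ q p, Sec (I.cocomplex.X q) U p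
  | 0, p => shiftD U (e 0) p
  | q + 1, p => shiftD U (e (q + 1)) p + (-1 : ℤ) ^ p • vert I U q p (e q p)

theorem resolutionD_toCochain (e : ∀ q p, Sec (I.cocomplex.X q) U p) (q : ℕ) :
    resolutionD (K := I.cocomplex) (fun q => toCochain.{u, w} U (e q)) q =
      toCochain U (ladderD I e q) := by
  match q with
  | 0 => exact totalD_toCochain _
  | q + 1 =>
    have h : ladderD I e (q + 1) = shiftD U (e (q + 1)) +
      fun p => (-1 : ℤ) ^ p • vert I U q p (e q p) := rfl
    rw [h, toCochain_add]
    funext p r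
    rw [resolutionD, totalD_toCochain, mapCochain_toCochain]
    exact congrArg _ (smul_toCochain _ p r)

/-- `IsLadder` constrains only the entries of total degree n - 1. Cutting off all others makes the
identity hold in every bidegree and gives the cochain the degree that `Represents` demands. -/
theorem IsLadder.ladderD_eq {n : ℕ} {s : intSheaf G ⟶ I.cocomplex.X n} {a : Sec F U n}
    {e : ∀ q p, Sec (I.cocomplex.X q) U p} (h : IsLadder I U n (U.globalSec s) a e) (q p : ℕ) :
    ladderD I (fun q p => if q + p + 1 = n then e q p else 0) q p =
      augSeq I a q p - sectionSeq U s q p := by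
  match q, p with
  | 0, 0 =>
    rw [ladderD, shiftD, augSeq, sectionSeq]
    cases n with
    | zero =>
      rw [IsLadder] at h
      rw [Pi.single_eq_same, Pi.single_eq_same, h, sub_self]
    | succ m =>
      rw [Pi.single_eq_of_ne (by omega), Pi.single_eq_of_ne (by omega), map_zero, sub_zero]
  | 0, p + 1 =>
    rw [ladderD, shiftD, augSeq, sectionSeq, sub_zero]
    by_cases hp : p + 1 = n
    · subst hp
      rw [if_pos (by omega), h.2.2, Pi.single_eq_same]
    · rw [if_neg (by omega), Pi.single_eq_of_ne hp, map_zero, map_zero]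
  | q + 1, 0 =>
    rw [ladderD, shiftD, augSeq, sectionSeq, pow_zero, one_smul, zero_add, zero_sub]
    by_cases hq : q + 1 = n
    · subst hq
      rw [if_pos (by omega), h.1, Pi.single_eq_same]
    · rw [if_neg (by omega), Pi.single_eq_of_ne hq, map_zero, neg_zero]
  | q + 1, p + 1 =>
    rw [ladderD, shiftD, augSeq, sectionSeq, sub_zero]
    by_cases hq : q + 1 + p + 1 = n
    · obtain ⟨m, rfl⟩ : ∃ m, n = m + 1 := ⟨n - 1, by omega⟩
      rw [if_pos hq, if_pos (by omega), h.2.1 q p (by omega), smul_smul, pow_succ, mul_neg_one,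
        neg_mul, ← mul_pow, neg_one_mul, neg_neg, one_pow, neg_smul, one_smul, add_neg_cancel]
    · rw [if_neg hq, if_neg (by omega), map_zero, map_zero, smul_zero, add_zero]

/-- Converse to `isLadder_of_resolutionD`: the ladder, viewed in Čech degree 0 of the one-index
family, is itself the trivialization. -/
theorem IsLadder.represents {n : ℕ} {s : intSheaf G ⟶ I.cocomplex.X n}
    (hs : s ≫ I.cocomplex.d n (n + 1) = 0) {a : Sec F U n}
    {e : ∀ q p, Sec (I.cocomplex.X q) U p} (h : IsLadder I U n (U.globalSec s) a e) :
    Represents n (toCochain.{u, w} U (Pi.single n a)) (I.extMk s (n + 1) rfl hs) := by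
  refine ⟨isCocycle_toCochain (h.secD_eq_zero (secD_globalSec s)), I, s, hs, rfl,
    fun q => toCochain U fun p => if q + p + 1 = n then e q p else 0,
    fun q p r hqpr => toCochain_eq_zero fun hr => if_neg (by omega), ?_⟩
  funext q
  rw [resolutionD_toCochain]
  change _ = augment (I.ι.f 0) (toCochain U (Pi.single n a)) q - ofSection s q
  rw [augment_toCochain, ofSection_eq_toCochain, ← toCochain_sub]
  exact congrArg _ (funext fun p => h.ladderD_eq q p)

theorem exists_isLadder_globalSec {n : ℕ} (s : intSheaf G ⟶ I.cocomplex.X n)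
    (hs : s ≫ I.cocomplex.d n (n + 1) = 0) :
    ∃ (V : IdentityNhd G) (a : Sec F V n) (e : ∀ q p, Sec (I.cocomplex.X q) V p),
      IsLadder I V n (V.globalSec s) a e := by
  -- The construction starts from all of BG and shrinks from there.
  let U : IdentityNhd G := ⟨fun _ => ⊤, fun _ => trivial, fun _ _ _ => trivial⟩
  obtain ⟨V, hV, a, e, h⟩ := exists_isLadder I n U (U.globalSec s)
    (by rw [vert, secMap_globalSec, hs, globalSec_zero]) (secD_globalSec s)
  rw [res_globalSec] at h
  exact ⟨V, a, e, h⟩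

end IdentityNhd

end

/-! ### The localization homomorphism -/

section

open IdentityNhd

variable (E : Type*) [AddCommGroup E] [Module ℝ E] [TopologicalSpace E] [FrechetSpace E]
  (EA : Type*) [AddCommGroup EA] [Module ℝ EA] [TopologicalSpace EA] [FrechetSpace EA]
  {G : Type u} [Group G] [TopologicalSpace G] [IsTopologicalGroup G] [ChartedSpace E G]
  [FrechetLieGroup E G]
  (A : Type u) [AddCommGroup A] [TopologicalSpace A] [IsTopologicalAddGroup A]
  [ChartedSpace EA A] [FrechetAddLieGroup EA A] [DistribMulAction G A] [SmoothAction E EA G A]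

/-- The germ `γ` corresponds to the global section `s` of an injective resolution: they are joined
by a ladder of sections over a simplicial neighbourhood of the unit. -/
def HasGerm (I : InjectiveResolution (coeffSheaf E EA G A)) (n : ℕ)
    (s : intSheaf G ⟶ I.cocomplex.X n) (γ : smoothGerms E EA G A n) : Prop :=
  ∃ (U : IdentityNhd G) (a : Sec (coeffSheaf E EA G A) U n)
    (e : ∀ q p, Sec (I.cocomplex.X q) U p),
    IsLadder I U n (U.globalSec s) a e ∧ secGerm E EA A U n a = γ

variable {E EA A} {I : InjectiveResolution (coeffSheaf E EA G A)} {n : ℕ}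
  {s s' : intSheaf G ⟶ I.cocomplex.X n} {γ γ' : smoothGerms E EA G A n}

theorem HasGerm.sub (h : HasGerm E EA A I n s γ) (h' : HasGerm E EA A I n s' γ') :
    HasGerm E EA A I n (s - s') (γ - γ') := by
  obtain ⟨U, a, e, hl, rfl⟩ := h
  obtain ⟨V, a', e', hl', rfl⟩ := h'
  have h2 := (hl.res (U.inf_le_left V)).sub (hl'.res (U.inf_le_right V))
  rw [res_globalSec, res_globalSec, ← globalSec_sub] at h2
  exact ⟨U ⊓ V, _, _, h2, by rw [map_sub, secGerm_res, secGerm_res]⟩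

theorem HasGerm.mem_localCocycles (h : HasGerm E EA A I n s γ) :
    γ ∈ localCocycles E EA G A n := by
  obtain ⟨U, a, e, hl, rfl⟩ := h
  change localD E EA G A n _ = 0
  rw [localD_secGerm, hl.secD_eq_zero (secD_globalSec s), map_zero]

/-- In degree 0 a vanishing class forces s = 0, hence a = 0. In higher degree s = dt for a global t,
and the ladder over an exact section ends in a local coboundary. -/
theorem HasGerm.mem_localCoboundaries (h : HasGerm E EA A I n s γ)
    (hs : s ≫ I.cocomplex.d n (n + 1) = 0) (h0 : I.extMk s (n + 1) rfl hs = 0) :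
    γ ∈ localCoboundaries E EA G A n := by
  obtain ⟨U, a, e, hl, rfl⟩ := h
  cases n with
  | zero =>
    have hz := InjectiveResolution.eq_zero_of_extMk_eq_zero I s hs h0
    rw [IsLadder, hz, globalSec_zero, ← map_zero (secMap (aug I) U 0)] at hl
    rw [aug_injective I 0 hl, map_zero]
    exact AddSubgroup.zero_mem _
  | succ m =>
    obtain ⟨t, rfl⟩ := (I.extMk_eq_zero_iff s _ rfl hs m rfl).1 h0
    obtain ⟨V, hV, c, hc⟩ := hl.exists_secD_eq (s := U.globalSec t) (secD_globalSec t)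
    exact ⟨secGerm E EA A V m c, by rw [localD_secGerm, hc, secGerm_res]⟩

theorem HasGerm.sub_mem (h : HasGerm E EA A I n s γ) (h' : HasGerm E EA A I n s' γ')
    (hs : s ≫ I.cocomplex.d n (n + 1) = 0) (hs' : s' ≫ I.cocomplex.d n (n + 1) = 0)
    (he : I.extMk s (n + 1) rfl hs = I.extMk s' (n + 1) rfl hs') :
    γ - γ' ∈ localCoboundaries E EA G A n :=
  (h.sub h').mem_localCoboundaries (by rw [Preadditive.sub_comp, hs, hs', sub_zero])
    (by rw [← I.sub_extMk s s' _ rfl hs hs', he, sub_self])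

variable (I) in
theorem exists_hasGerm (x : HDiff E EA G A n) :
    ∃ (s : intSheaf G ⟶ I.cocomplex.X n) (hs : s ≫ I.cocomplex.d n (n + 1) = 0)
      (γ : smoothGerms E EA G A n), I.extMk s (n + 1) rfl hs = x ∧ HasGerm E EA A I n s γ := by
  obtain ⟨s, hs, hx⟩ := I.extMk_surjective x (n + 1) rfl
  obtain ⟨V, a, e, h⟩ := exists_isLadder_globalSec s hs
  exact ⟨s, hs, _, hx, V, a, e, h, rfl⟩

/-- The resolution hidden in `Represents` is not the chosen one. A lift of the identity to a map of
resolutions preserves the class of s and carries the restricted ladder over with the same top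
section. -/
theorem SimplicialOpens.Represents.exists_hasGerm {𝒰 : SimplicialOpens.{u, w} G}
    {g : 𝒰.Cochain (coeffSheaf E EA G A)} {x : HDiff E EA G A n} (h : Represents n g x)
    (I : InjectiveResolution (coeffSheaf E EA G A))
    {v : 𝒰.index.obj (op (SimplexCategory.mk 0))} (hv : 1 ∈ 𝒰.opens _ v) :
    ∃ (s : intSheaf G ⟶ I.cocomplex.X n) (hs : s ≫ I.cocomplex.d n (n + 1) = 0),
      I.extMk s (n + 1) rfl hs = x ∧
        HasGerm E EA A I n s (topGerm E EA A g _ (distinguished_degen hv n)) := by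
  obtain ⟨hg, I', s, hs, rfl, b, -, hb⟩ := h
  let φ : InjectiveResolution.Hom I' I (𝟙 _) :=
    ⟨InjectiveResolution.desc (𝟙 _) I I', InjectiveResolution.desc_commutes_zero _ _ _⟩
  have hs' : (s ≫ φ.hom.f n) ≫ I.cocomplex.d n (n + 1) = 0 := by
    rw [Category.assoc, φ.hom.comm, ← Category.assoc, hs, Limits.zero_comp]
  refine ⟨s ≫ φ.hom.f n, hs', ?_, ?_⟩
  · rw [← InjectiveResolution.extMk_comp_mk₀ s (n + 1) rfl hs φ, Abelian.Ext.comp_mk₀_id]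
  · have hl := (isLadder_of_resolutionD hv hb).map φ.hom
      ((InjectiveResolution.desc_commutes_zero (𝟙 _) I I').trans (Category.id_comp _))
    exact ⟨𝒰.nhd hv, _, _, hl, coeffGerm_incl E EA A (toCell hv n) rfl
      (one_mem_cell fun _ => one_mem_degen hv _) _ _⟩

/-- Every class is represented by a cocycle on a simplicial family with a distinguished index. -/
theorem exists_represents (x : HDiff E EA G A n) :
    ∃ (𝒰 : SimplicialOpens.{u, w} G) (g : 𝒰.Cochain (coeffSheaf E EA G A)) (i : _),
      𝒰.Distinguished n i ∧ SimplicialOpens.Represents n g x := by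
  obtain ⟨I⟩ := HasInjectiveResolution.out (Z := coeffSheaf E EA G A)
  obtain ⟨s, hs, rfl⟩ := I.extMk_surjective x (n + 1) rfl
  obtain ⟨V, a, e, h⟩ := exists_isLadder_globalSec s hs
  exact ⟨V.family, _, _, SimplicialOpens.distinguished_degen (v := PUnit.unit) (V.one_mem _) n,
    h.represents hs⟩

variable (E EA G A n) in
/-- There is a homomorphism to local cohomology sending a represented class to the germ at a
distinguished index. -/
theorem exists_localization : ∃ loc : HDiff E EA G A n →+ HLoc E EA G A n,
    ∀ (𝒰 : SimplicialOpens.{u, w} G) (g : 𝒰.Cochain (coeffSheaf E EA G A))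
      (x : HDiff E EA G A n), SimplicialOpens.Represents n g x →
      ∀ i (hi : 𝒰.Distinguished n i),
        ∃ hc : topGerm E EA A g i hi ∈ localCocycles E EA G A n,
          loc x = QuotientAddGroup.mk ⟨topGerm E EA A g i hi, hc⟩ := by
  obtain ⟨I⟩ := HasInjectiveResolution.out (Z := coeffSheaf E EA G A)
  choose s hs γ hx hγ using exists_hasGerm (n := n) I
  let loc : HDiff E EA G A n →+ HLoc E EA G A n :=
    AddMonoidHom.mk' (fun x => QuotientAddGroup.mk ⟨γ x, (hγ x).mem_localCocycles⟩) fun x y => by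
      rw [← QuotientAddGroup.mk_add, QuotientAddGroup.eq, AddSubgroup.mem_addSubgroupOf]
      -- Additivity is obtained from differences of ladders: the germ γ(x) - (γ(x + y) - γ(y))
      -- belongs to a section of class x - ((x + y) - y) = 0.
      have h := ((hγ x).sub ((hγ (x + y)).sub (hγ y))).mem_localCoboundaries
        (by simp only [Preadditive.sub_comp, hs, sub_zero])
        (by
          rw [← I.sub_extMk _ _ _ rfl (hs x)
            (by simp only [Preadditive.sub_comp, hs, sub_zero]),
            ← I.sub_extMk _ _ _ rfl (hs (x + y)) (hs y), hx, hx, hx, add_sub_cancel_right,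
            sub_self])
      have h2 : -γ (x + y) + (γ x + γ y) = γ x - (γ (x + y) - γ y) := by abel
      rw [← h2] at h
      exact h
  refine ⟨loc, fun 𝒰 g x h i hi => ⟨h.1.topGerm_mem hi, ?_⟩⟩
  -- The degenerate index over a vertex of i mediates: its germ is cohomologous to γ(x) by the
  -- ladder argument, and to the germ at i by the cocycle identity.
  obtain ⟨v, hv⟩ := hi.exists_vertex
  obtain ⟨t, ht, htx, h1⟩ := h.exists_hasGerm I hv
  have h2 := AddSubgroup.add_mem _
    (h1.sub_mem (hγ x) ht (hs x) (htx.trans (hx x).symm))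
    (h.1.topGerm_sub_mem hi (SimplicialOpens.distinguished_degen hv n))
  refine QuotientAddGroup.eq.2 (AddSubgroup.mem_addSubgroupOf.2 ?_)
  have h3 : topGerm E EA A g _ (SimplicialOpens.distinguished_degen hv n) - γ x +
      (topGerm E EA A g i hi - topGerm E EA A g _ (SimplicialOpens.distinguished_degen hv n)) =
      -γ x + topGerm E EA A g i hi := by abel
  rw [h3] at h2
  exact h2

end

end DiffCoh

theorem proposition2p1
    (E : Type*) [AddCommGroup E] [Module ℝ E] [TopologicalSpace E] [DiffCoh.FrechetSpace E]
    (EA : Type*) [AddCommGroup EA] [Module ℝ EA] [TopologicalSpace EA] [DiffCoh.FrechetSpace EA]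
    (G : Type u) [Group G] [TopologicalSpace G] [IsTopologicalGroup G] [ChartedSpace E G]
    [DiffCoh.FrechetLieGroup E G]
    (A : Type u) [AddCommGroup A] [TopologicalSpace A] [IsTopologicalAddGroup A]
    [ChartedSpace EA A] [DiffCoh.FrechetAddLieGroup EA A] [DistribMulAction G A]
    [DiffCoh.SmoothAction E EA G A] (n : ℕ) :
    -- every simplicial open covering has a distinguished index in degree `n`
    (∀ 𝒰 : DiffCoh.SimplicialOpens.{u, w} G, 𝒰.IsCovering → ∃ i, 𝒰.Distinguished n i) ∧
    -- the top component of a Čech cocycle at a distinguished index is a local cocycle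
    (∀ (𝒰 : DiffCoh.SimplicialOpens.{u, w} G) (g : 𝒰.Cochain (DiffCoh.coeffSheaf E EA G A)),
      DiffCoh.SimplicialOpens.IsCocycle n g → ∀ i (hi : 𝒰.Distinguished n i),
        DiffCoh.topGerm E EA A g i hi ∈ DiffCoh.localCocycles E EA G A n) ∧
    -- up to local coboundaries it does not depend on the distinguished index
    (∀ (𝒰 : DiffCoh.SimplicialOpens.{u, w} G) (g : 𝒰.Cochain (DiffCoh.coeffSheaf E EA G A)),
      DiffCoh.SimplicialOpens.IsCocycle n g →
        ∀ i i' (hi : 𝒰.Distinguished n i) (hi' : 𝒰.Distinguished n i'),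
          DiffCoh.topGerm E EA A g i hi - DiffCoh.topGerm E EA A g i' hi' ∈
            DiffCoh.localCoboundaries E EA G A n) ∧
    -- there is one and only one localization map given by the top Čech component
    ∃! loc : DiffCoh.HDiff E EA G A n →+ DiffCoh.HLoc E EA G A n,
      ∀ (𝒰 : DiffCoh.SimplicialOpens.{u, w} G) (g : 𝒰.Cochain (DiffCoh.coeffSheaf E EA G A))
        (x : DiffCoh.HDiff E EA G A n), DiffCoh.SimplicialOpens.Represents n g x →
        ∀ i (hi : 𝒰.Distinguished n i),
          ∃ hc : DiffCoh.topGerm E EA A g i hi ∈ DiffCoh.localCocycles E EA G A n,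
            loc x = QuotientAddGroup.mk ⟨DiffCoh.topGerm E EA A g i hi, hc⟩ := by
  refine ⟨fun 𝒰 h => h.exists_distinguished n, fun 𝒰 g hg i hi => hg.topGerm_mem hi,
    fun 𝒰 g hg i i' hi hi' => hg.topGerm_sub_mem hi hi', ?_⟩
  obtain ⟨loc, hloc⟩ := DiffCoh.exists_localization.{u, w} E EA G A n
  refine ⟨loc, hloc, fun loc' hloc' => AddMonoidHom.ext fun x => ?_⟩
  -- Uniqueness holds because x has a representing cocycle on a one-index family. Such a family need
  -- not be a covering, so the quantification over all simplicial families is used here.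
  obtain ⟨𝒰, g, i, hi, h⟩ := DiffCoh.exists_represents.{u, w} x
  obtain ⟨_, h1⟩ := hloc 𝒰 g x h i hi
  obtain ⟨_, h2⟩ := hloc' 𝒰 g x h i hi
  exact h2.trans h1.symm
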